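/- Fix an integer $k\ge 0$. All maps are continuous. A triple $(f,U,y)$ is \emph{admissible} if $U\subseteq\mathbb R^k$ is open, $f$ is an $\mathbb R^k$-valued map defined at least on $\overline U$, $f$ is proper on $\overline U$ (the preimage in $\overline U$ of every compact set is compact), $y\in\mathbb R^k$, and $f(x)\ne y$ for all $x\in\partial U$. It is \emph{regular} if, in addition, $f$ is $C^\infty$ on $\overline U$ (that is, it has a $C^\infty$ extension to an open neighbourhood of $\overline U$) and $\det f'(x)\ne0$ for all $x\in f^{-1}(y)\cap U$. Let $\deg$ be either of the following. (a) The \emph{Brouwer degree}: for a regular triple, $\deg(g,U,z)=\sum_{x\in g^{-1}(z)\cap U}\operatorname{sign}\det g'(x)$; for an admissible triple, $\deg(f,U,y)=\deg(g,U,z)$, where $(g,U,z)$ is any regular triple such that for some $\varepsilon,\sigma>0$ one has $|f(x)-g(x)|\le\varepsilon$ on $\overline U$, $|y-z|\le\sigma$ and $\varepsilon+\sigma<\operatorname{dist}(y,f(\partial U))$ (with $\operatorname{dist}(y,\emptyset)=+\infty$). (b) Any map assigning an integer $\deg(f,U,y)$ to each admissible triple and satisfying the three Amann--Weiss axioms: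 - Normalization: $\deg(I,\mathbb R^k,0)=1$, where $I$ is the identity. - Additivity: if $(f,U,y)$ is admissible and $U_1,U_2$ are disjoint open subsets of $U$ with $f^{-1}(y)\cap U\subseteq U_1\cup U_2$, then $\deg(f,U,y)=\deg(f,U_1,y)+\deg(f,U_2,y)$. - Homotopy invariance: if $U\subseteq\mathbb R^k$ is open, $H$ is an $\mathbb R^k$-valued map which is proper on $\overline U\times[0,1]$, $\alpha:[0,1]\to\mathbb R^k$ is continuous, and $H(x,\lambda)\ne\alpha(\lambda)$ for all $(x,\lambda)\in\partial U\times[0,1]$, then $\deg(H(\cdot,0),U,\alpha(0))=\deg(H(\cdot,1),U,\alpha(1))$. Then: (i) $\deg(L,\mathbb R^k,y)=\operatorname{sign}\det L$ for every linear automorphism $L$ of $\mathbb R^k$ and every $y\in\mathbb R^k$. (ii) (Computation formula) Let $(f,U,y)$ be admissible, and suppose that at every $x\in f^{-1}(y)\cap U$ the map $f$ is Fréchet differentiable with nonsingular derivative $f'(x)$. Then $f^{-1}(y)\cap U$ is finite and $$\deg(f,U,y)=\sum_{x\in f^{-1}(y)\cap U}\operatorname{sign}\det f'(x).$$ -/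

import Mathlib

open Set

open scoped ContDiff

noncomputable section

/-- The Euclidean space `ℝ^k`. -/
abbrev Euc (k : ℕ) : Type := EuclideanSpace ℝ (Fin k)

/-- `f` is a proper (in particular continuous) map on the set `X`:
the preimage in `X` of every compact set is compact. Values of `f` outside `X` are irrelevant. -/
def ProperOn {A B : Type*} [TopologicalSpace A] [TopologicalSpace B] (f : A → B) (X : Set A) :
    Prop :=
  ContinuousOn f X ∧ ∀ K : Set B, IsCompact K → IsCompact (X ∩ f ⁻¹' K)

/-- Admissible triples `(f, U, y)`. A map defined (at least) on the closure of `U` is represented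
by a function on the whole space, of which only the values on `closure U` are constrained. -/
structure Admissible {k : ℕ} (f : Euc k → Euc k) (U : Set (Euc k)) (y : Euc k) : Prop where
  isOpen : IsOpen U
  proper : ProperOn f (closure U)
  boundary : ∀ x ∈ frontier U, f x ≠ y

/-- Admissible homotopies of triples `(H, U, α)`, with `H` on `closure U × [0,1]` and `α` a path
on `[0,1]`. -/
structure AdmissibleHomotopy {k : ℕ} (H : Euc k → ℝ → Euc k) (U : Set (Euc k))
    (α : ℝ → Euc k) : Prop where
  isOpen : IsOpen U
  path : ContinuousOn α (Icc 0 1)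
  proper : ProperOn (fun p : Euc k × ℝ => H p.1 p.2) (closure U ×ˢ Icc (0 : ℝ) 1)
  boundary : ∀ x ∈ frontier U, ∀ t ∈ Icc (0 : ℝ) 1, H x t ≠ α t

/-- A function on a subset `X` is smooth if it has a `C^∞` extension to an open neighbourhood
of `X`. -/
def SmoothOnSet {k : ℕ} (f : Euc k → Euc k) (X : Set (Euc k)) : Prop :=
  ∃ V : Set (Euc k), IsOpen V ∧ X ⊆ V ∧ ∃ g : Euc k → Euc k, ContDiffOn ℝ ∞ g V ∧ EqOn f g X

/-- Regular triples: admissible, with `f` smooth and `y` a regular value of `f` in `U`. -/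
structure RegularTriple {k : ℕ} (f : Euc k → Euc k) (U : Set (Euc k)) (y : Euc k) : Prop where
  admissible : Admissible f U y
  smooth : SmoothOnSet f (closure U)
  regular : ∀ x ∈ U, f x = y → (fderiv ℝ f x).det ≠ 0

/-- The index of `f` at `x`: the sign of the Jacobian determinant. -/
def index {k : ℕ} (f : Euc k → Euc k) (x : Euc k) : ℤ :=
  ((SignType.sign (fderiv ℝ f x).det : SignType) : ℤ)

/-- The degree of a regular triple: the sum of the indices of the (finitely many) solutions. -/
def regularDegree {k : ℕ} (f : Euc k → Euc k) (U : Set (Euc k)) (y : Euc k) : ℤ :=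
  ∑ᶠ x ∈ f ⁻¹' {y} ∩ U, index f x

/-- `(g, U, z)` is a regular triple such that `g` is `ε`-close to `f` on `closure U`, `z` is
`σ`-close to `y`, and `ε + σ < dist (y, f (∂U))`, where the distance to the empty set is `∞`. -/
def RegularApprox {k : ℕ} (f : Euc k → Euc k) (U : Set (Euc k)) (y : Euc k)
    (g : Euc k → Euc k) (z : Euc k) : Prop :=
  RegularTriple g U z ∧ ∃ ε σ : ℝ, 0 < ε ∧ 0 < σ ∧
    (∀ x ∈ closure U, ‖f x - g x‖ ≤ ε) ∧ ‖y - z‖ ≤ σ ∧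
    ENNReal.ofReal (ε + σ) < Metric.infEDist y (f '' frontier U)

open Classical in
/-- The Brouwer degree of a triple: the degree of any regular approximating triple
(and the junk value `0` if there is none, which does not happen for an admissible triple). -/
def brouwerDegree {k : ℕ} (f : Euc k → Euc k) (U : Set (Euc k)) (y : Euc k) : ℤ :=
  if h : ∃ p : (Euc k → Euc k) × Euc k, RegularApprox f U y p.1 p.2 then
    regularDegree h.choose.1 U h.choose.2
  else 0

/-- The three axioms of Amann and Weiss for an integer-valued map on the admissible triples
of `ℝ^k` (its values at other triples are irrelevant). -/
structure IsAmannWeissDegree {k : ℕ} (d : (Euc k → Euc k) → Set (Euc k) → Euc k → ℤ) :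
    Prop where
  normalization : d (fun x => x) univ 0 = 1
  additivity : ∀ (f : Euc k → Euc k) (U : Set (Euc k)) (y : Euc k) (U₁ U₂ : Set (Euc k)),
    Admissible f U y → IsOpen U₁ → IsOpen U₂ → U₁ ⊆ U → U₂ ⊆ U → Disjoint U₁ U₂ →
    f ⁻¹' {y} ∩ U ⊆ U₁ ∪ U₂ → d f U y = d f U₁ y + d f U₂ y
  homotopy : ∀ (H : Euc k → ℝ → Euc k) (U : Set (Euc k)) (α : ℝ → Euc k),
    AdmissibleHomotopy H U α →
    d (fun x => H x 0) U (α 0) = d (fun x => H x 1) U (α 1)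

end

/-! Near a solution with nonsingular derivative `A`, the map `f - y` differs from the linear map `A
(· - x)` by less than half of the latter's size. So solutions are isolated, and finite in number
because properness makes the solution set compact. On the boundary of a small ball around a
solution, the segment from `f - y` to the linear map avoids 0. The degree thus reduces to a sum of
degrees of linear maps, and `exists_radius_affine_approximation` serves both kinds of degree.

For the Brouwer degree the approximating regular triple must be shown irrelevant. If `φ` is
supported near 0, the integral of `φ(g) det g'` is the signed number of zeros of `g` times the
integral of `φ` (`integral_comp_mul_det_eq_regularDegree`, by change of variables). It is constant
along a homotopy because the pullback of the top-degree form `φ vol` is closed, so that Stokes on a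
box applies (`integral_comp_mul_det_eq_of_homotopy`). The two give `regularDegree_eq_of_homotopy`,
which also compares a smooth approximation of `f` with the linear map on each ball. The linear case
then follows from the computation formula.

For an axiomatic degree the linear case comes first. Folding space along a hyperplane gives a map
with one zero on each side and total degree 0, so a reflection reverses the sign
(`linear_comp_reflection`). Every nonsingular matrix is a product of transvections, which can be
deformed to the identity, and diagonal matrices, whose entries can be deformed to 1 or -1.
Additivity then isolates the solutions of a general `f`. -/

open MeasureTheory Filter Topology

/-! ### Closed forms and Stokes' theorem on a box -/

/-- The standard volume form of `ℝ^k`. -/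
noncomputable def volForm (k : ℕ) : Euc k [⋀^Fin k]→L[ℝ] ℝ :=
  { (EuclideanSpace.basisFun (Fin k) ℝ).toBasis.det with
    cont := by
      change Continuous fun v : Fin k → Euc k =>
        (EuclideanSpace.basisFun (Fin k) ℝ).toBasis.det v
      simp only [Module.Basis.det_apply]
      refine Continuous.matrix_det (continuous_matrix fun i j => ?_)
      simp only [Module.Basis.toMatrix_apply, OrthonormalBasis.coe_toBasis_repr_apply,
        EuclideanSpace.basisFun_repr]
      fun_prop }

theorem volForm_apply_basis {k : ℕ} (A : Euc k →L[ℝ] Euc k) :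
    volForm k (fun j => A (EuclideanSpace.single j 1)) = A.det := by
  have h := (EuclideanSpace.basisFun (Fin k) ℝ).toBasis.det_comp (A : Euc k →ₗ[ℝ] Euc k)
    (EuclideanSpace.basisFun (Fin k) ℝ).toBasis
  rw [Module.Basis.det_self, mul_one] at h
  rw [← ContinuousLinearMap.det] at h
  rw [← h]
  change (EuclideanSpace.basisFun (Fin k) ℝ).toBasis.det _ = _
  congr 1
  funext j
  simp

theorem topForm_extDeriv_eq_zero {k : ℕ} (η : Euc k → Euc k [⋀^Fin k]→L[ℝ] ℝ) (x : Euc k) :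
    extDeriv η x = 0 := by
  ext v
  refine AlternatingMap.map_linearDependent (extDeriv η x).toAlternatingMap v fun h => ?_
  simpa using h.fintype_card_le_finrank

/-- The form `φ · vol` pulled back along a smooth map `ℝ^(k+1) → ℝ^k` is closed. -/
theorem pullback_topForm {k : ℕ} {E : Type*} [NormedAddCommGroup E] [NormedSpace ℝ E]
    {φ : Euc k → ℝ} (hφ : ContDiff ℝ ∞ φ) {F : E → Euc k} {p : E} (hF : ContDiffAt ℝ ∞ F p) :
    DifferentiableAt ℝ (fun q => (φ (F q) • volForm k).compContinuousLinearMap (fderiv ℝ F q)) p ∧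
    extDeriv (fun q => (φ (F q) • volForm k).compContinuousLinearMap (fderiv ℝ F q)) p = 0 := by
  have hη : Differentiable ℝ fun y => φ y • volForm k :=
    (hφ.differentiable (by simp)).smul_const _
  constructor
  · have h1 : DifferentiableAt ℝ (fun q => φ (F q) • volForm k) p :=
      (hη (F p)).comp p (hF.differentiableAt (by simp))
    have h2 : DifferentiableAt ℝ (fderiv ℝ F) p :=
      (hF.fderiv_right (m := 1) (by norm_cast)).differentiableAt (by simp)
    exact (h1.hasFDerivAt.continuousAlternatingMapCompContinuousLinearMap
      h2.hasFDerivAt).differentiableAt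
  -- Pullback commutes with the exterior derivative, and `φ vol` already has top degree on `ℝ^k`.
  · have := extDeriv_pullback (hη (F p)) hF (by simpa using ENat.LEInfty.out)
    rw [this, topForm_extDeriv_eq_zero]
    rfl

/-- The projection `ℝ^(k+1) → ℝ^k` forgetting the first coordinate. -/
noncomputable def tailCLM (k : ℕ) : (Fin (k + 1) → ℝ) →L[ℝ] Euc k :=
  (EuclideanSpace.equiv (Fin k) ℝ).symm.toContinuousLinearMap ∘L
    ContinuousLinearMap.pi fun j => ContinuousLinearMap.proj j.succ

theorem tailCLM_cons {k : ℕ} (t : ℝ) (x : Fin k → ℝ) :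
    tailCLM k (Fin.cons t x) = WithLp.toLp 2 x := by
  ext j; simp [tailCLM]

/-- Being 1 near `C`, and not merely on it, is what lets a form multiplied by `ψ` keep its exterior
derivative over `C`. -/
theorem exists_cutoff {k : ℕ} {W C : Set (Euc k)} (hW : IsOpen W) (hC : IsCompact C)
    (hCW : C ⊆ W) : ∃ ψ : Euc k → ℝ, ContDiff ℝ ∞ ψ ∧ HasCompactSupport ψ ∧ tsupport ψ ⊆ W ∧
      ∀ x ∈ C, ∀ᶠ z in 𝓝 x, ψ z = 1 := by
  obtain ⟨K, hK, hCK, hKW⟩ := exists_compact_between hC hW hCW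
  obtain ⟨f, hf1, hf0, -⟩ := exists_contMDiffMap_one_nhds_of_subset_interior
    (modelWithCornersSelf ℝ (Euc k)) (n := ⊤) hC.isClosed hCK
  have hs : tsupport (f : Euc k → ℝ) ⊆ K :=
    closure_minimal (fun x hx => by_contra fun h => hx (hf0 x h)) hK.isClosed
  exact ⟨f, f.contMDiff.contDiff, hK.of_isClosed_subset (isClosed_tsupport _) hs,
    hs.trans hKW, fun x hx => (eventually_nhdsSet_iff_forall.1 hf1) x hx⟩

/-- Stokes' theorem for a form on a box which is closed and vanishes near the lateral faces. -/
theorem integral_faces_eq_of_closed {k : ℕ}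
    {η : (Fin (k + 1) → ℝ) → (Fin (k + 1) → ℝ) [⋀^Fin k]→L[ℝ] ℝ} (hd : Differentiable ℝ η)
    (hclosed : ∀ p, p 0 ∈ Ioo (0 : ℝ) 1 → extDeriv η p = 0) {R : ℝ} (hR : 0 ≤ R)
    (hsupp : ∀ p, (∃ j : Fin k, R ≤ |p j.succ|) → η p = 0) :
    ∫ x : Fin k → ℝ, η (Fin.cons 0 x) (fun j => Pi.single j.succ 1) =
      ∫ x : Fin k → ℝ, η (Fin.cons 1 x) (fun j => Pi.single j.succ 1) := by
  set e : Fin (k + 1) → Fin (k + 1) → ℝ := fun i => Pi.single i 1 with he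
  set a : Fin (k + 1) → ℝ := Fin.cons 0 (fun _ => -R) with ha
  set b : Fin (k + 1) → ℝ := Fin.cons 1 (fun _ => R) with hb
  set f : Fin (k + 1) → (Fin (k + 1) → ℝ) → ℝ :=
    fun i p => (-1) ^ i.val * η p (i.removeNth e) with hf
  have hfd : ∀ i, Differentiable ℝ (f i) := fun i p => by
    have := (hd p).continuousAlternatingMap_apply_const (i.removeNth e)
    exact this.const_mul _
  have hab : a ≤ b := by
    intro i
    refine Fin.cases ?_ (fun j => ?_) i
    · simp [ha, hb]
    · simp only [ha, hb, Fin.cons_succ]; linarith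
  have hdiv : ∀ p ∈ (pi Set.univ fun i => Ioo (a i) (b i)),
      ∑ i, fderiv ℝ (f i) p (e i) = 0 := by
    intro p hp
    have h0 := hp 0 (mem_univ _)
    simp only [ha, hb, Fin.cons_zero] at h0
    have h1 := extDeriv_apply (hd p) e
    rw [hclosed p h0] at h1
    change (0 : ℝ) = _ at h1
    rw [h1]
    refine Finset.sum_congr rfl fun i _ => ?_
    have h2 := (hd p).continuousAlternatingMap_apply_const (i.removeNth e)
    simp only [hf]
    rw [fderiv_const_mul h2, smul_apply, smul_eq_mul, zsmul_eq_mul]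
    simp
  classical
  -- Closedness is known only in the open box. Setting the derivative to 0 elsewhere makes the
  -- divergence vanish identically, so its integrability is trivial.
  set f' : Fin (k + 1) → (Fin (k + 1) → ℝ) → (Fin (k + 1) → ℝ) →L[ℝ] ℝ := fun i p =>
    if p ∈ (pi Set.univ fun i => Ioo (a i) (b i)) then fderiv ℝ (f i) p else 0 with hf'
  have hsum : ∀ p, ∑ i, f' i p (e i) = 0 := by
    intro p
    by_cases hp : p ∈ (pi Set.univ fun i => Ioo (a i) (b i))
    · simp only [hf', if_pos hp]; exact hdiv p hp
    · simp only [hf', if_neg hp]; simp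
  have key := integral_divergence_of_hasFDerivAt_off_countable' a b hab f f' ∅ countable_empty
    (fun i => (hfd i).continuous.continuousOn)
    (fun p hp i => by
      simp only [hf', if_pos hp.1]; exact (hfd i p).hasFDerivAt)
    (by
      have : (fun x => ∑ i, f' i x (Pi.single i 1)) = fun _ => (0 : ℝ) := funext hsum
      rw [this]; exact integrableOn_zero)
  have h0 : (∫ x in Icc a b, ∑ i, f' i x (Pi.single i 1)) = 0 := by
    have : (fun x => ∑ i, f' i x (Pi.single i 1)) = fun _ => (0 : ℝ) := funext hsum
    rw [this]; simp
  rw [h0, Fin.sum_univ_succ] at key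
  have hlat : ∀ (j : Fin k) (c : ℝ) (x : Fin k → ℝ), R ≤ |c| →
      f j.succ (j.succ.insertNth c x) = 0 := by
    intro j c x hc
    simp only [hf]
    rw [hsupp _ ⟨j, by simpa using hc⟩]
    simp
  have hz : ∑ i : Fin k,
      ((∫ x in Icc (a ∘ i.succ.succAbove) (b ∘ i.succ.succAbove),
          f i.succ (i.succ.insertNth (b i.succ) x)) -
        ∫ x in Icc (a ∘ i.succ.succAbove) (b ∘ i.succ.succAbove),
          f i.succ (i.succ.insertNth (a i.succ) x)) = 0 := by
    refine Finset.sum_eq_zero fun j _ => ?_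
    have h1 : ∀ x, f j.succ (j.succ.insertNth (b j.succ) x) = 0 := fun x =>
      hlat j _ x (by simp [hb, abs_of_nonneg hR])
    have h2 : ∀ x, f j.succ (j.succ.insertNth (a j.succ) x) = 0 := fun x =>
      hlat j _ x (by simp [ha, abs_of_nonneg hR])
    simp only [h1, h2]; simp
  rw [hz, add_zero] at key
  have hface : ∀ t : ℝ, ∫ x in Icc (a ∘ (0 : Fin (k + 1)).succAbove)
        (b ∘ (0 : Fin (k + 1)).succAbove), f 0 ((0 : Fin (k + 1)).insertNth t x) =
      ∫ x : Fin k → ℝ, η (Fin.cons t x) (fun j => Pi.single j.succ 1) := by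
    intro t
    have hfun : ∀ x : Fin k → ℝ, f 0 ((0 : Fin (k + 1)).insertNth t x) =
        η (Fin.cons t x) (fun j => Pi.single j.succ 1) := by
      intro x
      simp only [hf, Fin.insertNth_zero', Fin.val_zero, pow_zero, one_mul]
      congr 1
    simp only [hfun]
    refine setIntegral_eq_integral_of_forall_compl_eq_zero fun x hx => ?_
    have : ∃ j : Fin k, R ≤ |x j| := by
      by_contra! hcon
      refine hx ⟨fun j => ?_, fun j => ?_⟩
      · have := (abs_lt.1 (hcon j)).1
        simpa [ha] using this.le
      · have := (abs_lt.1 (hcon j)).2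
        simpa [hb] using this.le
    obtain ⟨j, hj⟩ := this
    rw [hsupp _ ⟨j, by simpa using hj⟩]
    simp
  rw [hface, hface] at key
  simp only [ha, hb, Fin.cons_zero] at key
  linarith

/-! ### Homotopy invariance of the Kronecker integral -/

/-- Homotopy invariance of the Kronecker integral under an affine homotopy of smooth maps. -/
theorem integral_comp_mul_det_eq_of_homotopy {k : ℕ} {g₀ g₁ : Euc k → Euc k} {W C : Set (Euc k)}
    (hW : IsOpen W) (hC : IsCompact C) (hCW : C ⊆ W) (h₀ : ContDiffOn ℝ ∞ g₀ W)
    (h₁ : ContDiffOn ℝ ∞ g₁ W) {φ : Euc k → ℝ} (hφ : ContDiff ℝ ∞ φ)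
    (hv : ∀ x ∈ W \ C, ∀ t ∈ Icc (0 : ℝ) 1, φ ((1 - t) • g₀ x + t • g₁ x) = 0) :
    ∫ x in W, φ (g₀ x) * (fderiv ℝ g₀ x).det = ∫ x in W, φ (g₁ x) * (fderiv ℝ g₁ x).det := by
  obtain ⟨ψ, hψ, hψc, hψW, hψ1⟩ := exists_cutoff hW hC hCW
  set F : (Fin (k + 1) → ℝ) → Euc k :=
    fun p => (1 - p 0) • g₀ (tailCLM k p) + p 0 • g₁ (tailCLM k p) with hF
  set w : (Fin (k + 1) → ℝ) → (Fin (k + 1) → ℝ) [⋀^Fin k]→L[ℝ] ℝ :=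
    fun q => (φ (F q) • volForm k).compContinuousLinearMap (fderiv ℝ F q) with hw
  set η : (Fin (k + 1) → ℝ) → (Fin (k + 1) → ℝ) [⋀^Fin k]→L[ℝ] ℝ :=
    fun q => ψ (tailCLM k q) • w q with hη
  have hproj : ContDiff ℝ ∞ fun p : Fin (k + 1) → ℝ => p 0 := contDiff_apply ℝ ℝ 0
  have hcomp : ∀ g : Euc k → Euc k, ContDiffOn ℝ ∞ g W → ∀ p, tailCLM k p ∈ W →
      ContDiffAt ℝ ∞ (fun p => g (tailCLM k p)) p := fun g hg p hp =>
    (hg.contDiffAt (hW.mem_nhds hp)).comp p (tailCLM k).contDiff.contDiffAt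
  have hFs : ∀ p, tailCLM k p ∈ W → ContDiffAt ℝ ∞ F p := fun p hp =>
    ((contDiffAt_const.sub hproj.contDiffAt).smul (hcomp g₀ h₀ p hp)).add
      (hproj.contDiffAt.smul (hcomp g₁ h₁ p hp))
  have hnear : ∀ p, tailCLM k p ∉ tsupport ψ → η =ᶠ[𝓝 p] fun _ => 0 := by
    intro p hp
    have : ∀ᶠ q in 𝓝 p, tailCLM k q ∈ (tsupport ψ)ᶜ :=
      (tailCLM k).continuous.continuousAt.eventually
        ((isClosed_tsupport ψ).isOpen_compl.mem_nhds hp)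
    filter_upwards [this] with q hq
    simp only [hη]
    rw [image_eq_zero_of_notMem_tsupport hq, zero_smul]
  have hηd : Differentiable ℝ η := by
    intro p
    by_cases hp : tailCLM k p ∈ W
    · have h1 : DifferentiableAt ℝ (fun q => ψ (tailCLM k q)) p :=
        ((hψ.differentiable (by simp)) _).comp p (tailCLM k).differentiableAt
      exact h1.smul (pullback_topForm hφ (hFs p hp)).1
    · exact (hnear p fun h => hp (hψW h)).differentiableAt_iff.2 (differentiableAt_const _)
  have hclosed : ∀ p, p 0 ∈ Ioo (0 : ℝ) 1 → extDeriv η p = 0 := by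
    have hconst : ∀ p, η =ᶠ[𝓝 p] (fun _ => 0) → extDeriv η p = 0 := by
      intro p hp
      rw [hp.extDeriv_eq]
      rw [extDeriv, fderiv_const_apply]
      exact map_zero (ContinuousAlternatingMap.alternatizeUncurryFinCLM ℝ
        (Fin (k + 1) → ℝ) ℝ)
    intro p hp
    -- Over `C` the cutoff is locally 1 and the pullback is closed; over `W \ C` the factor `φ (F
    -- q)` vanishes for `0 < t < 1`; off `W` the cutoff vanishes.
    by_cases hp1 : tailCLM k p ∈ W
    · by_cases hp2 : tailCLM k p ∈ C
      · have : η =ᶠ[𝓝 p] w := by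
          filter_upwards [(tailCLM k).continuous.continuousAt.eventually (hψ1 _ hp2)] with q hq
          simp only [hη]
          rw [hq, one_smul]
        rw [this.extDeriv_eq]
        exact (pullback_topForm hφ (hFs p hp1)).2
      · refine hconst p ?_
        have e1 : ∀ᶠ q in 𝓝 p, tailCLM k q ∈ W \ C :=
          (tailCLM k).continuous.continuousAt.eventually
            ((hW.sdiff hC.isClosed).mem_nhds ⟨hp1, hp2⟩)
        have e2 : ∀ᶠ q : Fin (k + 1) → ℝ in 𝓝 p, q 0 ∈ Ioo (0 : ℝ) 1 :=
          (continuous_apply (0 : Fin (k + 1))).continuousAt.eventually (isOpen_Ioo.mem_nhds hp)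
        filter_upwards [e1, e2] with q hq1 hq2
        simp only [hη, hw, hF]
        rw [hv _ hq1 _ (Ioo_subset_Icc_self hq2)]
        ext v
        simp
    · exact hconst p (hnear p fun h => hp1 (hψW h))
  obtain ⟨R, hR⟩ := hψc.isBounded.exists_pos_norm_lt
  have hsupp : ∀ p, (∃ j : Fin k, R ≤ |p j.succ|) → η p = 0 := by
    rintro p ⟨j, hj⟩
    refine (hnear p fun h => ?_).self_of_nhds
    have h1 := hR.2 _ h
    have h2 := PiLp.norm_apply_le (tailCLM k p) j
    have h3 : (tailCLM k p) j = p j.succ := by simp [tailCLM]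
    rw [h3, Real.norm_eq_abs] at h2
    linarith
  have key := integral_faces_eq_of_closed hηd hclosed hR.1.le hsupp
  have hval : ∀ (g : Euc k → Euc k) (hg : ContDiffOn ℝ ∞ g W) (t : ℝ) (s : Fin k → ℝ)
      (hgF : ∀ x, F (Fin.cons t x) = g (WithLp.toLp 2 x)),
      WithLp.toLp 2 s ∈ W → η (Fin.cons t s) (fun j => Pi.single j.succ 1) =
        ψ (WithLp.toLp 2 s) * (φ (g (WithLp.toLp 2 s)) * (fderiv ℝ g (WithLp.toLp 2 s)).det) := by
    intro g hg t s hgF hs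
    have hFd := ((hFs (Fin.cons t s) (by rwa [tailCLM_cons])).differentiableAt
      (by simp)).hasFDerivAt
    have hgd := ((hg.contDiffAt (hW.mem_nhds hs)).differentiableAt (by simp)).hasFDerivAt
    -- On the slice at height `t` the map `F` is `g`, so differentiating along coordinate lines
    -- inside the slice gives the columns of the Jacobian of `g`.
    have hdir : ∀ j : Fin k, fderiv ℝ F (Fin.cons t s) (Pi.single j.succ 1) =
        fderiv ℝ g (WithLp.toLp 2 s) (EuclideanSpace.single j 1) := by
      intro j
      have l1 : HasDerivAt (fun u : ℝ => (Fin.cons t s : Fin (k + 1) → ℝ) +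
          u • (Pi.single j.succ 1 : Fin (k + 1) → ℝ)) (Pi.single j.succ 1) 0 := by
        simpa using ((hasDerivAt_id (0 : ℝ)).smul_const
          (Pi.single j.succ 1 : Fin (k + 1) → ℝ)).const_add (Fin.cons t s)
      have l2 : HasDerivAt (fun u : ℝ => WithLp.toLp 2 s +
          u • (EuclideanSpace.single j 1 : Euc k)) (EuclideanSpace.single j 1) 0 := by
        simpa using ((hasDerivAt_id (0 : ℝ)).smul_const
          (EuclideanSpace.single j 1 : Euc k)).const_add (WithLp.toLp 2 s)
      have m1 := HasFDerivAt.comp_hasDerivAt (0 : ℝ) (l := F) (by simpa using hFd) l1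
      have m2 := HasFDerivAt.comp_hasDerivAt (0 : ℝ) (l := g) (by simpa using hgd) l2
      refine m1.unique ?_
      convert m2 using 1
      funext u
      have : (Fin.cons t s : Fin (k + 1) → ℝ) + u • (Pi.single j.succ 1 : Fin (k + 1) → ℝ) =
          Fin.cons t (s + u • (Pi.single j 1 : Fin k → ℝ)) := by
        funext i
        refine Fin.cases ?_ (fun i => ?_) i
        · simp
        · simp [Pi.single_apply]
      simp only [Function.comp_apply]
      rw [this, hgF]
      congr 1
    simp only [hη, hw, ContinuousAlternatingMap.smul_apply,
      ContinuousAlternatingMap.compContinuousLinearMap_apply, Function.comp_def, hdir, hgF,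
      tailCLM_cons, volForm_apply_basis, smul_eq_mul]
  have hfinal : ∀ (g : Euc k → Euc k) (hg : ContDiffOn ℝ ∞ g W) (t : ℝ)
      (hgF : ∀ x, F (Fin.cons t x) = g (WithLp.toLp 2 x)) (hgv : ∀ x ∈ W \ C, φ (g x) = 0),
      ∫ x : Fin k → ℝ, η (Fin.cons t x) (fun j => Pi.single j.succ 1) =
        ∫ x in W, φ (g x) * (fderiv ℝ g x).det := by
    intro g hg t hgF hgv
    have e1 : ∀ x : Fin k → ℝ, η (Fin.cons t x) (fun j => Pi.single j.succ 1) =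
        W.indicator (fun x => φ (g x) * (fderiv ℝ g x).det) (WithLp.toLp 2 x) := by
      intro x
      by_cases hx : WithLp.toLp 2 x ∈ W
      · rw [hval g hg t x hgF hx, indicator_of_mem hx]
        by_cases hx2 : WithLp.toLp 2 x ∈ C
        · rw [(hψ1 _ hx2).self_of_nhds, one_mul]
        · rw [hgv _ ⟨hx, hx2⟩]; simp
      · rw [indicator_of_notMem hx, (hnear _ _).self_of_nhds]
        · simp
        · rw [tailCLM_cons]; exact fun h => hx (hψW h)
    simp only [e1]
    rw [← integral_indicator hW.measurableSet]
    exact (EuclideanSpace.volume_preserving_symm_measurableEquiv_toLp (Fin k)).symm.integral_comp'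
      (W.indicator (fun x => φ (g x) * (fderiv ℝ g x).det))
  rw [hfinal g₀ h₀ 0 (fun x => by simp [hF, tailCLM_cons])
      (fun x hx => by simpa using hv x hx 0 (by simp)),
    hfinal g₁ h₁ 1 (fun x => by simp [hF, tailCLM_cons])
      (fun x hx => by simpa using hv x hx 1 (by simp))] at key
  exact key

/-! ### Nonsingular solutions and the degree of regular maps -/

theorem exists_pos_mul_norm_le_of_det_ne_zero {k : ℕ} {A : Euc k →L[ℝ] Euc k} (hA : A.det ≠ 0) :
    ∃ m > 0, ∀ v, m * ‖v‖ ≤ ‖A v‖ := by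
  set e := A.toContinuousLinearEquivOfDetNeZero hA with he
  -- The added 1 keeps the constant positive for `k = 0`, where the inverse has norm 0.
  have hpos : 0 < ‖(e.symm : Euc k →L[ℝ] Euc k)‖ + 1 := by positivity
  refine ⟨(‖(e.symm : Euc k →L[ℝ] Euc k)‖ + 1)⁻¹, inv_pos.2 hpos, fun v => ?_⟩
  rw [inv_mul_le_iff₀ hpos]
  have h := (e.symm : Euc k →L[ℝ] Euc k).le_opNorm (A v)
  have h2 : (e.symm : Euc k →L[ℝ] Euc k) (A v) = v := e.symm_apply_apply v
  rw [h2] at h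
  nlinarith [norm_nonneg (A v)]

theorem injective_of_det_ne_zero {k : ℕ} {A : Euc k →L[ℝ] Euc k} (hA : A.det ≠ 0) :
    Function.Injective A :=
  (A.toContinuousLinearEquivOfDetNeZero hA).injective

/-- A compact set of nonsingular solutions is finite. -/
theorem IsCompact.finite_of_det_fderiv_ne_zero {k : ℕ} {f : Euc k → Euc k} {K : Set (Euc k)}
    {y : Euc k} (hK : IsCompact K)
    (h : ∀ x ∈ K, f x = y ∧ DifferentiableAt ℝ f x ∧ (fderiv ℝ f x).det ≠ 0) : K.Finite := by
  -- Differentiability at `x` alone isolates the solution: another solution `z` nearby would give `m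
  -- ‖z - x‖ ≤ (m / 2) ‖z - x‖`.
  have hU : ∀ x ∈ K, {z | f z = y → z = x} ∈ 𝓝 x := by
    intro x hx
    obtain ⟨hy, hd, hdet⟩ := h x hx
    obtain ⟨m, hm, hmA⟩ := exists_pos_mul_norm_le_of_det_ne_zero hdet
    have hlo := hd.hasFDerivAt.isLittleO.def (half_pos hm)
    filter_upwards [hlo] with z hz hzy
    rw [hzy, hy, sub_self, zero_sub, norm_neg] at hz
    have h1 := hmA (z - x)
    have h2 : ‖z - x‖ = 0 := le_antisymm (by nlinarith) (norm_nonneg _)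
    exact sub_eq_zero.1 (norm_eq_zero.1 h2)
  obtain ⟨t, -, ht⟩ := hK.elim_nhds_subcover _ hU
  refine t.finite_toSet.subset fun z hz => ?_
  obtain ⟨x, hx, hzx⟩ := mem_iUnion₂.1 (ht hz)
  rw [hzx (h z hz).1]
  exact hx

/-- The inverse function theorem gives injectivity and an open image. The constant sign is needed to
replace the Jacobian determinant by the index times its absolute value in the change of variables.
-/
theorem exists_local_inverse_neighborhood {k : ℕ} {g : Euc k → Euc k} {x : Euc k}
    (hg : ContDiffAt ℝ ∞ g x) (hdet : (fderiv ℝ g x).det ≠ 0) {N : Set (Euc k)} (hN : N ∈ 𝓝 x) :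
    ∃ A, IsOpen A ∧ x ∈ A ∧ A ⊆ N ∧ InjOn g A ∧ IsOpen (g '' A) ∧
      ∀ z ∈ A, SignType.sign (fderiv ℝ g z).det = SignType.sign (fderiv ℝ g x).det := by
  have hs : HasStrictFDerivAt g
      (((fderiv ℝ g x).toContinuousLinearEquivOfDetNeZero hdet : Euc k ≃L[ℝ] Euc k) :
        Euc k →L[ℝ] Euc k) x := by
    simpa using hg.hasStrictFDerivAt (by simp)
  have hcont : ContinuousAt (fun z => (fderiv ℝ g z).det) x :=
    ContinuousLinearMap.continuous_det.continuousAt.comp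
      (hg.fderiv_right (m := 0) (by norm_cast)).continuousAt
  have hsign : ∀ᶠ z in 𝓝 x,
      SignType.sign (fderiv ℝ g z).det = SignType.sign (fderiv ℝ g x).det := by
    rcases lt_or_gt_of_ne hdet with h | h
    · filter_upwards [hcont.eventually (gt_mem_nhds h)] with z hz
      rw [sign_neg hz, sign_neg h]
    · filter_upwards [hcont.eventually (lt_mem_nhds h)] with z hz
      rw [sign_pos hz, sign_pos h]
  obtain ⟨V, hV, hVo, hxV⟩ := mem_nhds_iff.1 (Filter.inter_mem hN hsign)
  set e := hs.toOpenPartialHomeomorph g with he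
  refine ⟨e.source ∩ V, e.open_source.inter hVo, ⟨hs.mem_toOpenPartialHomeomorph_source, hxV⟩,
    fun z hz => (hV hz.2).1, e.injOn.mono inter_subset_left, ?_, fun z hz => (hV hz.2).2⟩
  exact e.isOpen_image_of_subset_source (e.open_source.inter hVo) inter_subset_left

/-- The degree of a regular map is given by its Kronecker integral. -/
theorem integral_comp_mul_det_eq_regularDegree {k : ℕ} {g : Euc k → Euc k} {W C : Set (Euc k)}
    (hW : IsOpen W) (hC : IsCompact C) (hCW : C ⊆ W) (hg : ContDiffOn ℝ ∞ g W) {c : ℝ}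
    (hc : 0 < c) (hgc : ∀ x ∈ W \ C, c ≤ ‖g x‖)
    (hreg : ∀ x ∈ W, g x = 0 → (fderiv ℝ g x).det ≠ 0) :
    ∃ δ > 0, ∀ φ : Euc k → ℝ, Continuous φ → (∀ v, δ ≤ ‖v‖ → φ v = 0) →
      ∫ x in W, φ (g x) * (fderiv ℝ g x).det = (regularDegree g W 0 : ℝ) * ∫ v, φ v := by
  have hat : ∀ x ∈ W, ContDiffAt ℝ ∞ g x := fun x hx => hg.contDiffAt (hW.mem_nhds hx)
  have hSC : g ⁻¹' {0} ∩ W ⊆ C := by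
    rintro x ⟨hx0, hxW⟩
    by_contra hxC
    have := hgc x ⟨hxW, hxC⟩
    rw [hx0, norm_zero] at this
    linarith
  have hgC : ContinuousOn g C := hg.continuousOn.mono hCW
  have hSeq : g ⁻¹' {0} ∩ W = C ∩ g ⁻¹' {0} :=
    Subset.antisymm (fun x hx => ⟨hSC hx, hx.1⟩) fun x hx => ⟨hx.2, hCW hx.1⟩
  have hScomp : IsCompact (g ⁻¹' {0} ∩ W) := by
    rw [hSeq]
    exact hC.of_isClosed_subset (hgC.preimage_isClosed_of_isClosed hC.isClosed isClosed_singleton)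
      inter_subset_left
  have hS : (g ⁻¹' {0} ∩ W).Finite := hScomp.finite_of_det_fderiv_ne_zero (f := g) (y := 0)
    fun x hx => ⟨hx.1, (hat x hx.2).differentiableAt (by simp), hreg x hx.2 hx.1⟩
  obtain ⟨N, hN, hdisj⟩ := hS.t2_separation
  have hloc : ∀ x, ∃ A : Set (Euc k), x ∈ g ⁻¹' {0} ∩ W → (IsOpen A ∧ x ∈ A ∧ A ⊆ N x ∩ W ∧
      InjOn g A ∧ IsOpen (g '' A) ∧
      ∀ z ∈ A, SignType.sign (fderiv ℝ g z).det = SignType.sign (fderiv ℝ g x).det) := by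
    intro x
    by_cases hx : x ∈ g ⁻¹' {0} ∩ W
    · obtain ⟨A, hA⟩ := exists_local_inverse_neighborhood (hat x hx.2) (hreg x hx.2 hx.1)
        (Filter.inter_mem ((hN x).2.mem_nhds (hN x).1) (hW.mem_nhds hx.2))
      exact ⟨A, fun _ => hA⟩
    · exact ⟨∅, fun h => absurd h hx⟩
  choose A hA using hloc
  have hball : ∀ᶠ δ : ℝ in 𝓝[>] 0, ∀ x ∈ g ⁻¹' {0} ∩ W, Metric.ball 0 δ ⊆ g '' A x := by
    rw [eventually_all_finite hS]
    intro x hx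
    obtain ⟨ho, hxA, -, -, hio, -⟩ := hA x hx
    obtain ⟨δ, hδ, hsub⟩ := Metric.isOpen_iff.1 hio 0 ⟨x, hxA, hx.1⟩
    filter_upwards [Ioo_mem_nhdsGT hδ] with δ' hδ'
    exact (Metric.ball_subset_ball hδ'.2.le).trans hsub
  -- Off the chosen neighbourhoods of the zeros, `‖g‖` has a positive minimum on the rest of `C` and
  -- is at least `c` outside `C`. Hence `φ (g x)` lives only on those neighbourhoods.
  have hout : ∀ᶠ δ : ℝ in 𝓝[>] 0, ∀ x ∈ W \ ⋃ x ∈ g ⁻¹' {0} ∩ W, A x, δ ≤ ‖g x‖ := by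
    have hK : IsCompact (C \ ⋃ x ∈ g ⁻¹' {0} ∩ W, A x) :=
      hC.diff (isOpen_biUnion fun x hx => (hA x hx).1)
    have hpos : ∃ δ > 0, ∀ x ∈ C \ ⋃ x ∈ g ⁻¹' {0} ∩ W, A x, δ ≤ ‖g x‖ := by
      rcases (C \ ⋃ x ∈ g ⁻¹' {0} ∩ W, A x).eq_empty_or_nonempty with he | hne
      · exact ⟨1, one_pos, fun x hx => absurd (he ▸ hx) (notMem_empty x)⟩
      · obtain ⟨x, hx, hmin⟩ := hK.exists_isMinOn hne (hgC.mono sdiff_subset).norm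
        refine ⟨‖g x‖, norm_pos_iff.2 fun h0 => hx.2 ?_, fun z hz => hmin hz⟩
        have hxS : x ∈ g ⁻¹' {0} ∩ W := ⟨h0, hCW hx.1⟩
        exact mem_biUnion hxS (hA x hxS).2.1
    obtain ⟨δ, hδ, hδC⟩ := hpos
    filter_upwards [Ioo_mem_nhdsGT (lt_min hδ hc)] with δ' hδ' x hx
    have h := lt_min_iff.1 hδ'.2
    by_cases hxC : x ∈ C
    · exact h.1.le.trans (hδC x ⟨hxC, hx.2⟩)
    · exact h.2.le.trans (hgc x ⟨hx.1, hxC⟩)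
  obtain ⟨δ, ⟨hδb, hδo⟩, hδ⟩ := ((hball.and hout).and self_mem_nhdsWithin).exists
  refine ⟨δ, hδ, fun φ hφ hφ0 => ?_⟩
  have hφsupp : HasCompactSupport φ := HasCompactSupport.intro (isCompact_closedBall 0 δ)
    fun v hv => hφ0 v (by
      have := (not_le.1 (fun h => hv (mem_closedBall_zero_iff.2 h))).le
      exact this)
  have hφint : Integrable φ := hφ.integrable_of_hasCompactSupport hφsupp
  have hpiece : ∀ x ∈ g ⁻¹' {0} ∩ W,
      IntegrableOn (fun z => φ (g z) * (fderiv ℝ g z).det) (A x) ∧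
      ∫ z in A x, φ (g z) * (fderiv ℝ g z).det = (index g x : ℝ) * ∫ v, φ v := by
    intro x hx
    obtain ⟨ho, hxA, hsub, hinj, hio, hsgn⟩ := hA x hx
    have hder : ∀ z ∈ A x, HasFDerivWithinAt g (fderiv ℝ g z) (A x) z := fun z hz =>
      ((hat z (hsub hz).2).differentiableAt (by simp)).hasFDerivAt.hasFDerivWithinAt
    have hEq : EqOn (fun z => φ (g z) * (fderiv ℝ g z).det)
        (fun z => (index g x : ℝ) * (|(fderiv ℝ g z).det| • φ (g z))) (A x) := by
      intro z hz
      have h1 := sign_mul_abs (fderiv ℝ g z).det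
      rw [hsgn z hz] at h1
      have h2 : (index g x : ℝ) = ((SignType.sign (fderiv ℝ g x).det : SignType) : ℝ) := by
        rw [index]; push_cast; rfl
      simp only [smul_eq_mul]
      rw [h2]
      nth_rewrite 1 [← h1]
      ring
    have hI := (integrableOn_image_iff_integrableOn_abs_det_fderiv_smul volume ho.measurableSet
      hder hinj φ).1 hφint.integrableOn
    refine ⟨(integrableOn_congr_fun hEq ho.measurableSet).2 (hI.const_mul _), ?_⟩
    rw [setIntegral_congr_fun ho.measurableSet hEq, integral_const_mul,
      ← integral_image_eq_integral_abs_det_fderiv_smul volume ho.measurableSet hder hinj φ]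
    congr 1
    refine setIntegral_eq_integral_of_forall_compl_eq_zero fun v hv => hφ0 v ?_
    by_contra hlt
    exact hv (hδb x hx (mem_ball_zero_iff.2 (not_le.1 hlt)))
  have hUW : (⋃ x ∈ g ⁻¹' {0} ∩ W, A x) ⊆ W :=
    iUnion₂_subset fun x hx => (hA x hx).2.2.1.trans inter_subset_right
  rw [setIntegral_eq_of_subset_of_forall_sdiff_eq_zero hW.measurableSet hUW
    (fun x hx => by rw [hφ0 _ (hδo x hx), zero_mul])]
  have hset : (⋃ x ∈ g ⁻¹' {0} ∩ W, A x) = ⋃ x ∈ hS.toFinset, A x := by simp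
  rw [hset, integral_biUnion_finset hS.toFinset
    (fun x hx => (hA x (hS.mem_toFinset.1 hx)).1.measurableSet)
    (fun x hx z hz hxz => (hdisj (hS.mem_toFinset.1 hx) (hS.mem_toFinset.1 hz) hxz).mono
      ((hA x (hS.mem_toFinset.1 hx)).2.2.1.trans inter_subset_left)
      ((hA z (hS.mem_toFinset.1 hz)).2.2.1.trans inter_subset_left))
    (fun x hx => (hpiece x (hS.mem_toFinset.1 hx)).1),
    Finset.sum_congr rfl fun x hx => (hpiece x (hS.mem_toFinset.1 hx)).2, ← Finset.sum_mul]
  congr 1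
  rw [regularDegree, finsum_mem_eq_finite_toFinset_sum _ hS]
  push_cast
  rfl

/-- Homotopy invariance of the degree of regular maps. -/
theorem regularDegree_eq_of_homotopy {k : ℕ} {g₀ g₁ : Euc k → Euc k} {z₀ z₁ : Euc k}
    {W C : Set (Euc k)} (hW : IsOpen W) (hC : IsCompact C) (hCW : C ⊆ W)
    (h₀ : ContDiffOn ℝ ∞ g₀ W) (h₁ : ContDiffOn ℝ ∞ g₁ W) {c : ℝ} (hc : 0 < c)
    (hhom : ∀ x ∈ W \ C, ∀ t ∈ Icc (0 : ℝ) 1, c ≤ ‖(1 - t) • (g₀ x - z₀) + t • (g₁ x - z₁)‖)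
    (hr₀ : ∀ x ∈ W, g₀ x = z₀ → (fderiv ℝ g₀ x).det ≠ 0)
    (hr₁ : ∀ x ∈ W, g₁ x = z₁ → (fderiv ℝ g₁ x).det ≠ 0) :
    regularDegree g₀ W z₀ = regularDegree g₁ W z₁ := by
  have htr : ∀ (g : Euc k → Euc k) (z : Euc k),
      regularDegree g W z = regularDegree (fun x => g x - z) W 0 := by
    intro g z
    have h1 : (fun x => g x - z) ⁻¹' {0} = g ⁻¹' {z} := by
      ext x; simp [sub_eq_zero]
    simp only [regularDegree, h1, index, fderiv_sub_const]
  rw [htr g₀, htr g₁]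
  have k₀ : ContDiffOn ℝ ∞ (fun x => g₀ x - z₀) W := h₀.sub contDiffOn_const
  have k₁ : ContDiffOn ℝ ∞ (fun x => g₁ x - z₁) W := h₁.sub contDiffOn_const
  obtain ⟨δ₀, hδ₀, H₀⟩ := integral_comp_mul_det_eq_regularDegree hW hC hCW k₀ hc
    (fun x hx => by simpa using hhom x hx 0 (by simp))
    (fun x hx h => by rw [fderiv_sub_const]; exact hr₀ x hx (sub_eq_zero.1 h))
  obtain ⟨δ₁, hδ₁, H₁⟩ := integral_comp_mul_det_eq_regularDegree hW hC hCW k₁ hc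
    (fun x hx => by simpa using hhom x hx 1 (by simp))
    (fun x hx h => by rw [fderiv_sub_const]; exact hr₁ x hx (sub_eq_zero.1 h))
  -- The bound `c` makes the bump vanish on the homotopy outside `C`; `δ₀` and `δ₁` make both
  -- integral formulas valid.
  set δ := min c (min δ₀ δ₁) with hδ
  have hδpos : 0 < δ := lt_min hc (lt_min hδ₀ hδ₁)
  let b : ContDiffBump (0 : Euc k) := ⟨δ / 2, δ, half_pos hδpos, half_lt_self hδpos⟩
  have hb0 : ∀ v : Euc k, δ ≤ ‖v‖ → b v = 0 := fun v hv =>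
    b.zero_of_le_dist (by simpa using hv)
  have e₀ := H₀ b b.continuous fun v hv =>
    hb0 v (((min_le_right _ _).trans (min_le_left _ _)).trans hv)
  have e₁ := H₁ b b.continuous fun v hv =>
    hb0 v (((min_le_right _ _).trans (min_le_right _ _)).trans hv)
  have e := integral_comp_mul_det_eq_of_homotopy hW hC hCW k₀ k₁ (φ := b) b.contDiff
    fun x hx t ht => hb0 _ ((min_le_left _ _).trans (hhom x hx t ht))
  rw [e₀, e₁] at e
  exact_mod_cast mul_right_cancel₀ (b.integral_pos (μ := volume)).ne' e

/-! ### Admissible triples and their regular approximations -/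

/-- Balls are convex, so a segment between two vectors close to `a` stays close to `a`. This is the
source of the nonvanishing of the straight-line homotopies between approximations. -/
theorem le_norm_affine_combination {E : Type*} [NormedAddCommGroup E] [NormedSpace ℝ E]
    {a b₀ b₁ : E} {e t : ℝ} (h₀ : ‖b₀ - a‖ ≤ e) (h₁ : ‖b₁ - a‖ ≤ e) (ht : t ∈ Icc (0 : ℝ) 1) :
    ‖a‖ - e ≤ ‖(1 - t) • b₀ + t • b₁‖ := by
  have hmem : (1 - t) • b₀ + t • b₁ ∈ Metric.closedBall a e :=
    (convex_closedBall a e) (mem_closedBall_iff_norm.2 h₀) (mem_closedBall_iff_norm.2 h₁)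
      (sub_nonneg.2 ht.2) ht.1 (by ring)
  have h := mem_closedBall_iff_norm'.1 hmem
  have := norm_sub_norm_le a ((1 - t) • b₀ + t • b₁)
  linarith

theorem mem_preimage_closedBall_iff {α E : Type*} [SeminormedAddCommGroup E] {f : α → E} {x : α}
    {y : E} {r : ℝ} : x ∈ f ⁻¹' Metric.closedBall y r ↔ ‖f x - y‖ ≤ r := by
  rw [mem_preimage, mem_closedBall_iff_norm]

namespace Admissible

variable {k : ℕ} {f : Euc k → Euc k} {U : Set (Euc k)} {y : Euc k}

theorem mem_of_mem_closure (h : Admissible f U y) {x : Euc k} (hx : x ∈ closure U)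
    (hfr : x ∉ frontier U) : x ∈ U := by
  by_contra hxU
  exact hfr ⟨hx, by rwa [h.isOpen.interior_eq]⟩

theorem mem_of_eq (h : Admissible f U y) {x : Euc k} (hx : x ∈ closure U) (hfx : f x = y) :
    x ∈ U :=
  h.mem_of_mem_closure hx fun hfr => h.boundary x hfr hfx

theorem isCompact_preimage (h : Admissible f U y) : IsCompact (f ⁻¹' {y} ∩ U) := by
  have : f ⁻¹' {y} ∩ U = closure U ∩ f ⁻¹' {y} :=
    Subset.antisymm (fun x hx => ⟨subset_closure hx.2, hx.1⟩)
      fun x hx => ⟨hx.2, h.mem_of_eq hx.1 hx.2⟩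
  rw [this]
  exact h.proper.2 _ isCompact_singleton

theorem finite_preimage (h : Admissible f U y)
    (hd : ∀ x ∈ f ⁻¹' {y} ∩ U, DifferentiableAt ℝ f x ∧ (fderiv ℝ f x).det ≠ 0) :
    (f ⁻¹' {y} ∩ U).Finite :=
  h.isCompact_preimage.finite_of_det_fderiv_ne_zero fun x hx => ⟨hx.1, hd x hx⟩

theorem isCompact_inter_preimage_closedBall (h : Admissible f U y) (z : Euc k) (r : ℝ) :
    IsCompact (closure U ∩ f ⁻¹' Metric.closedBall z r) := by
  have hb : IsCompact (Metric.closedBall z r) := isCompact_closedBall z r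
  exact h.proper.2 _ hb

/-- On a closed set without solutions, a proper map stays away from the value `y`. -/
theorem exists_pos_le_norm_sub (h : Admissible f U y) {X : Set (Euc k)} (hX : IsClosed X)
    (hXU : X ⊆ closure U) (hne : ∀ x ∈ X, f x ≠ y) : ∃ r > 0, ∀ x ∈ X, r ≤ ‖f x - y‖ := by
  -- Only points with value within 1 of `y` matter, and properness makes them a compact set even
  -- when `U` is unbounded.
  set K := (closure U ∩ f ⁻¹' Metric.closedBall y 1) ∩ X with hK
  have hKc : IsCompact K := (h.isCompact_inter_preimage_closedBall y 1).inter_right hX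
  rcases K.eq_empty_or_nonempty with he | hn
  · refine ⟨1, one_pos, fun x hx => ?_⟩
    by_contra! hlt
    have : x ∈ K := ⟨⟨hXU hx, mem_preimage_closedBall_iff.2 hlt.le⟩, hx⟩
    rw [he] at this
    exact this
  · have hc : ContinuousOn (fun x => ‖f x - y‖) K :=
      ((h.proper.1.mono fun x hx => hx.1.1).sub continuousOn_const).norm
    obtain ⟨x, hx, hmin⟩ := hKc.exists_isMinOn hn hc
    refine ⟨min 1 ‖f x - y‖, lt_min one_pos (norm_pos_iff.2 (sub_ne_zero.2 (hne x hx.2))),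
      fun z hz => ?_⟩
    by_cases hzK : ‖f z - y‖ ≤ 1
    · exact (min_le_right _ _).trans (hmin ⟨⟨hXU hz, mem_preimage_closedBall_iff.2 hzK⟩, hz⟩)
    · exact (min_le_left _ _).trans (not_le.1 hzK).le

/-- Regular approximations by Tietze's theorem, smoothing and Sard's theorem. -/
theorem exists_regularTriple_near (h : Admissible f U y) {η : ℝ} (hη : 0 < η)
    (hfr : ∀ x ∈ frontier U, 3 * η ≤ ‖f x - y‖) :
    ∃ (g : Euc k → Euc k) (z : Euc k), ContDiff ℝ ∞ g ∧ (∀ x ∈ closure U, ‖f x - g x‖ ≤ η) ∧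
      ‖y - z‖ ≤ η ∧ RegularTriple g U z := by
  obtain ⟨F, hF⟩ := ContinuousMap.exists_restrict_eq (isClosed_closure (s := U))
    ⟨(closure U).domRestrict f, h.proper.1.domRestrict⟩
  have hFf : ∀ x ∈ closure U, F x = f x := fun x hx =>
    congrArg (fun q : C(closure U, Euc k) => q ⟨x, hx⟩) hF
  obtain ⟨g, hg, hgF, -⟩ := F.continuous.exists_contDiff_approx ⊤ (ε := fun _ => η)
    continuous_const fun _ => hη
  have hfg : ∀ x ∈ closure U, ‖f x - g x‖ ≤ η := fun x hx => by
    rw [← hFf x hx, ← dist_eq_norm, dist_comm]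
    exact (hgF x).le
  have hsard : volume (g '' {x | (fderiv ℝ g x).det = 0}) = 0 :=
    addHaar_image_eq_zero_of_det_fderivWithin_eq_zero volume
      (fun x _ => ((hg.differentiable (by simp)) x).hasFDerivAt.hasFDerivWithinAt) fun x hx => hx
  -- By Sard the critical values have measure zero, so they cannot fill a ball around `y`.
  obtain ⟨z, hzy, hz⟩ : (Metric.ball y η ∩ (g '' {x | (fderiv ℝ g x).det = 0})ᶜ).Nonempty := by
    by_contra hne
    rw [not_nonempty_iff_eq_empty, ← disjoint_iff_inter_eq_empty,
      disjoint_compl_right_iff_subset] at hne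
    exact (Metric.measure_ball_pos volume y hη).ne' (measure_mono_null hne hsard)
  have hyz : ‖y - z‖ < η := mem_ball_iff_norm'.1 hzy
  refine ⟨g, z, hg, hfg, hyz.le, ⟨h.isOpen, ⟨hg.continuous.continuousOn, fun K hK => ?_⟩,
    fun x hx hgx => ?_⟩, ⟨univ, isOpen_univ, subset_univ _, g, hg.contDiffOn, fun _ _ => rfl⟩,
    fun x _ hgx hdet => hz ⟨x, hdet, hgx⟩⟩
  -- Properness passes from `f` to `g` because the two differ by at most `η`: where `‖g x‖ ≤ R`, one
  -- has `‖f x‖ ≤ R + η`.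
  · obtain ⟨R, hR⟩ := hK.isBounded.subset_closedBall (0 : Euc k)
    refine (h.isCompact_inter_preimage_closedBall 0 (R + η)).of_isClosed_subset
      (isClosed_closure.inter (hK.isClosed.preimage hg.continuous)) fun x hx => ⟨hx.1, ?_⟩
    have h1 := mem_closedBall_zero_iff.1 (hR hx.2)
    have h2 := norm_sub_norm_le (f x) (g x)
    have h3 := hfg x hx.1
    exact mem_closedBall_zero_iff.2 (by linarith)
  · have h1 := hfr x hx
    have h2 := hfg x (frontier_subset_closure hx)
    have h3 : f x - y = (f x - g x) + (z - y) := by rw [hgx]; abel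
    have h4 := norm_add_le (f x - g x) (z - y)
    rw [← h3, norm_sub_rev z y] at h4
    linarith

end Admissible

theorem SmoothOnSet.contDiffOn {k : ℕ} {g : Euc k → Euc k} {U : Set (Euc k)}
    (h : SmoothOnSet g (closure U)) : ContDiffOn ℝ ∞ g U := by
  obtain ⟨V, -, hUV, G, hG, hgG⟩ := h
  exact (hG.mono (subset_closure.trans hUV)).congr fun x hx => hgG (subset_closure hx)

/-- A real `s` fits strictly between `ε + σ` and the possibly infinite distance. This disposes of
the extended reals and covers an empty frontier too. -/
theorem RegularApprox.exists_real {k : ℕ} {f g : Euc k → Euc k} {U : Set (Euc k)} {y z : Euc k}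
    (h : RegularApprox f U y g z) : ∃ e s : ℝ, e < s ∧ (∀ x ∈ frontier U, s < ‖f x - y‖) ∧
      ∀ x ∈ closure U, ‖(g x - z) - (f x - y)‖ ≤ e := by
  obtain ⟨-, ε, σ, hε, hσ, hfg, hyz, hdist⟩ := h
  obtain ⟨s, hs0, hs1, hs2⟩ := ENNReal.lt_iff_exists_real_btwn.1 hdist
  refine ⟨ε + σ, s, (ENNReal.ofReal_lt_ofReal_iff_of_nonneg (by positivity)).1 hs1,
    fun x hx => ?_, fun x hx => ?_⟩
  · have h1 := hs2.trans_le (Metric.infEDist_le_edist_of_mem (mem_image_of_mem f hx))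
    rw [edist_dist] at h1
    rw [← dist_eq_norm, dist_comm]
    exact (ENNReal.ofReal_lt_ofReal_iff_of_nonneg hs0).1 h1
  · have h1 : (g x - z) - (f x - y) = -(f x - g x) + (y - z) := by abel
    rw [h1]
    refine (norm_add_le _ _).trans ?_
    rw [norm_neg]
    exact add_le_add (hfg x hx) hyz

/-- The degree of a regular approximation does not depend on the approximation. -/
theorem RegularApprox.regularDegree_eq {k : ℕ} {f g₀ g₁ : Euc k → Euc k} {U : Set (Euc k)}
    {y z₀ z₁ : Euc k} (hf : Admissible f U y) (h₀ : RegularApprox f U y g₀ z₀)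
    (h₁ : RegularApprox f U y g₁ z₁) : regularDegree g₀ U z₀ = regularDegree g₁ U z₁ := by
  obtain ⟨e₀, s₀, hes₀, hfr₀, hg₀⟩ := h₀.exists_real
  obtain ⟨e₁, s₁, hes₁, hfr₁, hg₁⟩ := h₁.exists_real
  set s := max s₀ s₁ with hs
  set e := max e₀ e₁ with he
  have hes : e < s := max_lt (hes₀.trans_le (le_max_left _ _)) (hes₁.trans_le (le_max_right _ _))
  -- This `C` is compact by properness and avoids the frontier, where `‖f x - y‖ > s`. Outside it,
  -- both approximations are within `e` of a vector longer than `s`, so the segment has norm at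
  -- least `s - e`.
  refine regularDegree_eq_of_homotopy hf.isOpen (C := closure U ∩ f ⁻¹' Metric.closedBall y s)
    (hf.isCompact_inter_preimage_closedBall y s) (fun x hx => ?_) h₀.1.smooth.contDiffOn
    h₁.1.smooth.contDiffOn (sub_pos.2 hes) (fun x hx t ht => ?_) h₀.1.regular h₁.1.regular
  · refine hf.mem_of_mem_closure hx.1 fun hfr => ?_
    have h2 := mem_preimage_closedBall_iff.1 hx.2
    exact absurd h2 (not_le.2 (max_lt (hfr₀ x hfr) (hfr₁ x hfr)))
  · have hxc := subset_closure hx.1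
    have h2 : s < ‖f x - y‖ := by
      by_contra! hle
      exact hx.2 ⟨hxc, mem_preimage_closedBall_iff.2 hle⟩
    have := le_norm_affine_combination ((hg₀ x hxc).trans (le_max_left _ e₁))
      ((hg₁ x hxc).trans (le_max_right e₀ _)) ht
    linarith

theorem RegularApprox.brouwerDegree_eq {k : ℕ} {f g : Euc k → Euc k} {U : Set (Euc k)}
    {y z : Euc k} (hf : Admissible f U y) (h : RegularApprox f U y g z) :
    brouwerDegree f U y = regularDegree g U z := by
  have hex : ∃ p : (Euc k → Euc k) × Euc k, RegularApprox f U y p.1 p.2 := ⟨(g, z), h⟩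
  rw [brouwerDegree, dif_pos hex]
  exact RegularApprox.regularDegree_eq hf hex.choose_spec h

/-! ### The computation formula for the Brouwer degree -/

theorem hasFDerivAt_affine {k : ℕ} (A : Euc k →L[ℝ] Euc k) (x₀ y x : Euc k) :
    HasFDerivAt (fun x => y + A (x - x₀)) A x :=
  (A.hasFDerivAt.comp x ((hasFDerivAt_id x).sub_const x₀)).const_add y

theorem regularDegree_affine {k : ℕ} {A : Euc k →L[ℝ] Euc k} (hA : A.det ≠ 0) (x₀ y : Euc k)
    {W : Set (Euc k)} (hx : x₀ ∈ W) :
    regularDegree (fun x => y + A (x - x₀)) W y = ((SignType.sign A.det : SignType) : ℤ) := by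
  have hset : (fun x => y + A (x - x₀)) ⁻¹' {y} ∩ W = {x₀} := by
    ext x
    simp only [mem_inter_iff, mem_preimage, mem_singleton_iff, add_eq_left]
    constructor
    · rintro ⟨h, -⟩
      exact sub_eq_zero.1 (injective_of_det_ne_zero hA (h.trans A.map_zero.symm))
    · rintro rfl
      simpa using hx
  rw [regularDegree, hset, finsum_mem_singleton, index, (hasFDerivAt_affine A x₀ y x₀).fderiv]

/-- A radius on which the affine approximations at finitely many nonsingular solutions are good. -/
theorem exists_radius_affine_approximation {k : ℕ} {f : Euc k → Euc k} {U S : Set (Euc k)}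
    {y : Euc k} (hU : IsOpen U) (hS : S.Finite)
    (hd : ∀ x ∈ S, x ∈ U ∧ f x = y ∧ DifferentiableAt ℝ f x ∧ (fderiv ℝ f x).det ≠ 0) :
    ∃ r > 0, ∃ m > 0, S.PairwiseDisjoint (fun x => Metric.closedBall x r) ∧
      ∀ x ∈ S, Metric.closedBall x r ⊆ U ∧ ∀ z ∈ Metric.closedBall x r, ∀ t ∈ Icc (0 : ℝ) 1,
        m * ‖z - x‖ ≤ ‖(1 - t) • (f z - y) + t • fderiv ℝ f x (z - x)‖ := by
  obtain ⟨N, hN, hdisj⟩ := hS.t2_separation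
  -- Of the lower bound `2m` for the derivative, one `m` absorbs the differentiation error and the
  -- other remains in the conclusion.
  have hm : ∀ᶠ m : ℝ in 𝓝[>] 0, ∀ x ∈ S, ∀ v, (m + m) * ‖v‖ ≤ ‖fderiv ℝ f x v‖ := by
    rw [eventually_all_finite hS]
    intro x hx
    obtain ⟨m, hm, hmv⟩ := exists_pos_mul_norm_le_of_det_ne_zero (hd x hx).2.2.2
    filter_upwards [Ioo_mem_nhdsGT (half_pos hm)] with m' hm' v
    exact (mul_le_mul_of_nonneg_right (by linarith [hm'.2]) (norm_nonneg v)).trans (hmv v)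
  obtain ⟨m, hmS, hm0⟩ := (hm.and self_mem_nhdsWithin).exists
  have hr : ∀ᶠ r : ℝ in 𝓝[>] 0, ∀ x ∈ S, Metric.closedBall x r ⊆
      (N x ∩ U) ∩ {z | ‖f z - f x - fderiv ℝ f x (z - x)‖ ≤ m * ‖z - x‖} := by
    rw [eventually_all_finite hS]
    intro x hx
    have hnh := Filter.inter_mem (Filter.inter_mem ((hN x).2.mem_nhds (hN x).1)
      (hU.mem_nhds (hd x hx).1)) ((hd x hx).2.2.1.hasFDerivAt.isLittleO.def hm0)
    obtain ⟨r, hr, hsub⟩ := Metric.nhds_basis_closedBall.mem_iff.1 hnh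
    filter_upwards [Ioo_mem_nhdsGT hr] with r' hr'
    exact (Metric.closedBall_subset_closedBall hr'.2.le).trans hsub
  obtain ⟨r, hrS, hr0⟩ := (hr.and self_mem_nhdsWithin).exists
  refine ⟨r, hr0, m, hm0, fun x hx z hz hxz => (hdisj hx hz hxz).mono
    (fun w hw => (hrS x hx hw).1.1) fun w hw => (hrS z hz hw).1.1,
    fun x hx => ⟨fun w hw => (hrS x hx hw).1.2, fun z hz t ht => ?_⟩⟩
  have h1 : ‖f z - f x - fderiv ℝ f x (z - x)‖ ≤ m * ‖z - x‖ := (hrS x hx hz).2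
  rw [(hd x hx).2.1] at h1
  have h2 := le_norm_affine_combination (b₁ := fderiv ℝ f x (z - x)) h1
    (by rw [sub_self, norm_zero]; exact (norm_nonneg _).trans h1) ht
  have h3 := hmS x hx (z - x)
  linarith

/-- The computation formula for the Brouwer degree. -/
theorem brouwerDegree_eq_sum_index {k : ℕ} {f : Euc k → Euc k} {U : Set (Euc k)} {y : Euc k}
    (h : Admissible f U y)
    (hd : ∀ x ∈ f ⁻¹' {y} ∩ U, DifferentiableAt ℝ f x ∧ (fderiv ℝ f x).det ≠ 0) :
    brouwerDegree f U y = ∑ x ∈ (h.finite_preimage hd).toFinset, index f x := by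
  set S := f ⁻¹' {y} ∩ U with hSdef
  have hS : S.Finite := h.finite_preimage hd
  obtain ⟨r, hr, m, hm, hdisj, hloc⟩ := exists_radius_affine_approximation h.isOpen hS
    (y := y) fun x hx => ⟨hx.2, hx.1, hd x hx⟩
  have hballU : ∀ x ∈ S, Metric.ball x r ⊆ U := fun x hx =>
    Metric.ball_subset_closedBall.trans (hloc x hx).1
  set X := closure U \ ⋃ x ∈ S, Metric.ball x r with hX
  have hXc : IsClosed X := isClosed_closure.sdiff (isOpen_biUnion fun x _ => Metric.isOpen_ball)
  obtain ⟨ρ, hρ, hρX⟩ := h.exists_pos_le_norm_sub hXc sdiff_subset fun x hx hfx =>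
    hx.2 (mem_biUnion (show x ∈ S from ⟨hfx, h.mem_of_eq hx.1 hfx⟩) (Metric.mem_ball_self hr))
  have hfrX : frontier U ⊆ X := fun x hx => ⟨frontier_subset_closure hx, fun hmem => by
    obtain ⟨z, hz, hxz⟩ := mem_iUnion₂.1 hmem
    exact (h.isOpen.frontier_eq ▸ hx).2 (hballU z hz hxz)⟩
  -- The map `g - z` is within `2η` of `f - y`. The bound `ρ / 4` leaves no solution of `g = z`
  -- outside the balls; `m * r / 16` keeps the error below the size `m * r / 2` of the segment from
  -- `f - y` to the derivative where `‖w - x‖ ≥ r / 2`.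
  set η := min (ρ / 4) (m * r / 16) with hη
  have hη0 : 0 < η := lt_min (by positivity) (by positivity)
  have hη1 : η ≤ ρ / 4 := min_le_left _ _
  have hη2 : η ≤ m * r / 16 := min_le_right _ _
  obtain ⟨g, z, hg, hfg, hyz, hreg⟩ := h.exists_regularTriple_near hη0 fun x hx => by
    have := hρX x (hfrX hx)
    linarith
  have hclose : ∀ x ∈ closure U, ‖(g x - z) - (f x - y)‖ ≤ η + η := fun x hx => by
    have h1 : (g x - z) - (f x - y) = -(f x - g x) + (y - z) := by abel
    rw [h1]
    refine (norm_add_le _ _).trans ?_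
    rw [norm_neg]
    exact add_le_add (hfg x hx) hyz
  have happ : RegularApprox f U y g z := by
    refine ⟨hreg, η, η, hη0, hη0, hfg, hyz, ?_⟩
    refine lt_of_lt_of_le ((ENNReal.ofReal_lt_ofReal_iff hρ).2 (by linarith : η + η < ρ)) ?_
    refine Metric.le_infEDist.2 ?_
    rintro _ ⟨x, hx, rfl⟩
    rw [edist_dist, dist_comm, dist_eq_norm]
    exact ENNReal.ofReal_le_ofReal (hρX x (hfrX hx))
  rw [happ.brouwerDegree_eq h]
  have hfin : (g ⁻¹' {z} ∩ U).Finite := hreg.admissible.finite_preimage fun x hx =>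
    ⟨(hg.differentiable (by simp)) x, hreg.regular x hx.2 hx.1⟩
  have hsplit : g ⁻¹' {z} ∩ U = ⋃ x ∈ S, (g ⁻¹' {z} ∩ Metric.ball x r) := by
    ext w
    simp only [mem_iUnion, exists_prop]
    constructor
    · rintro ⟨hw, hwU⟩
      have hwX : w ∉ X := fun hwX => by
        have h1 := hρX w hwX
        have h2 := hclose w (subset_closure hwU)
        rw [show g w = z from hw, sub_self, zero_sub, norm_neg] at h2
        linarith
      have : w ∈ ⋃ x ∈ S, Metric.ball x r := by
        by_contra hcon
        exact hwX ⟨subset_closure hwU, hcon⟩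
      obtain ⟨x, hx, hwx⟩ := mem_iUnion₂.1 this
      exact ⟨x, hx, hw, hwx⟩
    · rintro ⟨x, hx, hw, hwx⟩
      exact ⟨hw, hballU x hx hwx⟩
  rw [regularDegree, hsplit, finsum_mem_biUnion
    (fun x hx w hw hxw => ((hdisj hx hw hxw).mono Metric.ball_subset_closedBall
      Metric.ball_subset_closedBall).mono inter_subset_right inter_subset_right) hS
    (fun x hx => hfin.subset fun w hw => ⟨hw.1, hballU x hx hw.2⟩),
    finsum_mem_eq_finite_toFinset_sum _ hS]
  refine Finset.sum_congr rfl fun x hx => ?_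
  have hxS : x ∈ S := hS.mem_toFinset.1 hx
  have hdet := (hd x hxS).2
  rw [index, ← regularDegree_affine hdet x y (Metric.mem_ball_self hr)]
  -- Since `f` need not be smooth, its approximation `g` is deformed to the affine map; the
  -- half-radius closed ball is the compact set off which the homotopy is bounded below.
  refine regularDegree_eq_of_homotopy Metric.isOpen_ball
    (isCompact_closedBall x (r / 2)) (Metric.closedBall_subset_ball (half_lt_self hr))
    hg.contDiffOn (contDiff_const.add
      ((fderiv ℝ f x).contDiff.comp (contDiff_id.sub contDiff_const))).contDiffOn
    (c := m * r / 8) (by positivity) (fun w hw t ht => ?_)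
    (fun w hw => hreg.regular w (hballU x hxS hw)) (fun w _ _ => ?_)
  · have h1 := (hloc x hxS).2 w (Metric.ball_subset_closedBall hw.1) t ht
    have h2 : r / 2 ≤ ‖w - x‖ := by
      by_contra! hlt
      exact hw.2 (mem_closedBall_iff_norm.2 hlt.le)
    have h3 := hclose w (subset_closure (hballU x hxS hw.1))
    have h4 : (1 - t) • (g w - z) + t • (y + fderiv ℝ f x (w - x) - y) =
        ((1 - t) • (f w - y) + t • fderiv ℝ f x (w - x)) +
          (1 - t) • ((g w - z) - (f w - y)) := by
      rw [add_sub_cancel_left, smul_sub (1 - t) (g w - z)]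
      abel
    rw [h4]
    have h5 := norm_sub_le_norm_add ((1 - t) • (f w - y) + t • fderiv ℝ f x (w - x))
      ((1 - t) • ((g w - z) - (f w - y)))
    have h6 : ‖(1 - t) • ((g w - z) - (f w - y))‖ ≤ η + η := by
      rw [norm_smul, Real.norm_of_nonneg (sub_nonneg.2 ht.2)]
      have := norm_nonneg ((g w - z) - (f w - y))
      nlinarith [ht.1]
    have h7 : m * (r / 2) ≤ m * ‖w - x‖ := mul_le_mul_of_nonneg_left h2 hm.le
    linarith
  · rw [(hasFDerivAt_affine _ x y w).fderiv]
    exact hdet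

/-! ### First consequences of the Amann–Weiss axioms -/

theorem properOn_of_isBounded {k : ℕ} {f : Euc k → Euc k} {U : Set (Euc k)}
    (hU : Bornology.IsBounded U) (hf : ContinuousOn f (closure U)) : ProperOn f (closure U) :=
  ⟨hf, fun _ hK => hU.isCompact_closure.of_isClosed_subset
    (hf.preimage_isClosed_of_isClosed isClosed_closure hK.isClosed) inter_subset_left⟩

theorem le_norm_of_mem_frontier_ball {k : ℕ} {R : ℝ} {x : Euc k}
    (hx : x ∈ frontier (Metric.ball (0 : Euc k) R)) : R ≤ ‖x‖ := by
  rw [Metric.isOpen_ball.frontier_eq] at hx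
  by_contra! hlt
  exact hx.2 (mem_ball_zero_iff.2 hlt)

namespace Admissible

variable {k : ℕ} {f : Euc k → Euc k} {U : Set (Euc k)} {y : Euc k}

/-- Restriction of an admissible triple to an open subset. -/
theorem mono (h : Admissible f U y) {V : Set (Euc k)} (hV : IsOpen V) (hVU : V ⊆ U)
    (hz : ∀ x ∈ f ⁻¹' {y} ∩ U, x ∈ closure V → x ∈ V) : Admissible f V y := by
  refine ⟨hV, ⟨h.proper.1.mono (closure_mono hVU), fun K hK => ?_⟩, fun x hx hfx => ?_⟩
  · have : closure V ∩ f ⁻¹' K = (closure U ∩ f ⁻¹' K) ∩ closure V := by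
      ext x
      constructor
      · rintro ⟨h1, h2⟩; exact ⟨⟨closure_mono hVU h1, h2⟩, h1⟩
      · rintro ⟨⟨-, h2⟩, h1⟩; exact ⟨h1, h2⟩
    rw [this]
    exact (h.proper.2 K hK).inter_right isClosed_closure
  · have hxc := frontier_subset_closure hx
    exact (hV.frontier_eq ▸ hx).2 (hz x ⟨hfx, h.mem_of_eq (closure_mono hVU hxc) hfx⟩ hxc)

end Admissible

theorem admissible_empty {k : ℕ} (f : Euc k → Euc k) (y : Euc k) : Admissible f ∅ y :=
  ⟨isOpen_empty, by simp [ProperOn], by simp⟩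

theorem admissible_continuousLinearMap {k : ℕ} {L : Euc k →L[ℝ] Euc k} (hL : L.det ≠ 0)
    (y : Euc k) : Admissible (fun x => L x) univ y := by
  refine ⟨isOpen_univ, ⟨L.continuous.continuousOn, fun K hK => ?_⟩, by simp⟩
  have h := (L.toContinuousLinearEquivOfDetNeZero hL).toHomeomorph.isClosedEmbedding
  rw [closure_univ, univ_inter]
  exact h.isCompact_preimage hK

namespace IsAmannWeissDegree

variable {k : ℕ} {d : (Euc k → Euc k) → Set (Euc k) → Euc k → ℤ}

/-- Additivity with all sets empty reads `d = d + d`. -/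
theorem empty (hd : IsAmannWeissDegree d) (f : Euc k → Euc k) (y : Euc k) : d f ∅ y = 0 := by
  have := hd.additivity f ∅ y ∅ ∅ (admissible_empty f y) isOpen_empty isOpen_empty
    subset_rfl subset_rfl (disjoint_empty _) (by simp)
  linarith

theorem excision (hd : IsAmannWeissDegree d) {f : Euc k → Euc k} {U V : Set (Euc k)} {y : Euc k}
    (h : Admissible f U y) (hV : IsOpen V) (hVU : V ⊆ U) (hz : f ⁻¹' {y} ∩ U ⊆ V) :
    d f U y = d f V y := by
  have := hd.additivity f U y V ∅ h hV isOpen_empty hVU (empty_subset _) (disjoint_empty _)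
    (by simpa using hz)
  rw [this, hd.empty, add_zero]

theorem eq_zero (hd : IsAmannWeissDegree d) {f : Euc k → Euc k} {U : Set (Euc k)} {y : Euc k}
    (h : Admissible f U y) (hz : ∀ x ∈ U, f x ≠ y) : d f U y = 0 := by
  rw [hd.excision h isOpen_empty (empty_subset _) (fun x hx => hz x hx.2 hx.1), hd.empty]

theorem homotopy_of_isBounded (hd : IsAmannWeissDegree d) {H : Euc k → ℝ → Euc k}
    {U : Set (Euc k)} {α : ℝ → Euc k} (hU : IsOpen U) (hb : Bornology.IsBounded U)
    (hα : ContinuousOn α (Icc 0 1))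
    (hH : ContinuousOn (fun p : Euc k × ℝ => H p.1 p.2) (closure U ×ˢ Icc (0 : ℝ) 1))
    (hfr : ∀ x ∈ frontier U, ∀ t ∈ Icc (0 : ℝ) 1, H x t ≠ α t) :
    d (fun x => H x 0) U (α 0) = d (fun x => H x 1) U (α 1) :=
  hd.homotopy H U α ⟨hU, hα, ⟨hH, fun _ hK =>
    (hb.isCompact_closure.prod isCompact_Icc).of_isClosed_subset
      (hH.preimage_isClosed_of_isClosed (isClosed_closure.prod isClosed_Icc) hK.isClosed)
      inter_subset_left⟩, hfr⟩

/-- On a bounded set properness is automatic, so moving map and target value along segments at once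
leaves only a nonvanishing condition on the frontier. -/
theorem affine_homotopy (hd : IsAmannWeissDegree d) {f g : Euc k → Euc k}
    {U : Set (Euc k)} {y z : Euc k} (hU : IsOpen U) (hb : Bornology.IsBounded U)
    (hf : ContinuousOn f (closure U)) (hg : ContinuousOn g (closure U))
    (hfr : ∀ x ∈ frontier U, ∀ t ∈ Icc (0 : ℝ) 1, (1 - t) • (f x - y) + t • (g x - z) ≠ 0) :
    d f U y = d g U z := by
  have hfst : MapsTo (Prod.fst : Euc k × ℝ → Euc k) (closure U ×ˢ Icc (0 : ℝ) 1) (closure U) :=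
    fun p hp => hp.1
  have h := hd.homotopy_of_isBounded (H := fun x t => (1 - t) • f x + t • g x)
    (α := fun t => (1 - t) • y + t • z) hU hb (by fun_prop)
    (((continuous_const.sub continuous_snd).continuousOn.smul
      (hf.comp continuous_fst.continuousOn hfst)).add
      (continuous_snd.continuousOn.smul (hg.comp continuous_fst.continuousOn hfst)))
    (fun x hx t ht heq => hfr x hx t ht (by
      rw [← sub_eq_zero] at heq
      rw [← heq, smul_sub, smul_sub]
      abel))
  simpa using h

/-- The axioms do not say outright that values off `closure U` are irrelevant; for bounded `U` this
follows from a homotopy that is constant on `closure U`. -/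
theorem congr (hd : IsAmannWeissDegree d) {f g : Euc k → Euc k} {U : Set (Euc k)} {y : Euc k}
    (h : Admissible f U y) (hb : Bornology.IsBounded U) (hfg : EqOn g f (closure U)) :
    d f U y = d g U y := by
  refine hd.affine_homotopy h.isOpen hb h.proper.1 (h.proper.1.congr hfg) fun x hx t _ => ?_
  rw [hfg (frontier_subset_closure hx), ← add_smul, sub_add_cancel, one_smul]
  exact sub_ne_zero.2 (h.boundary x hx)

/-! ### Linear maps under the axioms -/

/-- The degree of `x ↦ A (x - x₀)` near `x₀` does not depend on `x₀` and the neighbourhood. -/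
theorem linear_sub (hd : IsAmannWeissDegree d) {A : Euc k →L[ℝ] Euc k} (hA : A.det ≠ 0)
    {U : Set (Euc k)} (hU : IsOpen U) (hb : Bornology.IsBounded U) {x₀ : Euc k} (hx : x₀ ∈ U) :
    d (fun x => A (x - x₀)) U 0 = d (fun x => A x) (Metric.ball 0 1) 0 := by
  have hinj : ∀ v, A v = 0 → v = 0 := fun v hv =>
    injective_of_det_ne_zero hA (hv.trans A.map_zero.symm)
  obtain ⟨R', hR'⟩ := hb.subset_ball (0 : Euc k)
  set R := max R' 2 with hR
  have hUR : U ⊆ Metric.ball 0 R := hR'.trans (Metric.ball_subset_ball (le_max_left _ _))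
  have hxR : ‖x₀‖ < R := mem_ball_zero_iff.1 (hUR hx)
  have h1R : (1 : ℝ) ≤ R := one_le_two.trans (le_max_right _ _)
  have hbR : Bornology.IsBounded (Metric.ball (0 : Euc k) R) := Metric.isBounded_ball
  have hfr : ∀ x ∈ frontier (Metric.ball (0 : Euc k) R), R ≤ ‖x‖ := fun x hx => le_norm_of_mem_frontier_ball hx
  have hadm : ∀ z : Euc k, ‖z‖ < R → Admissible (fun x => A (x - z)) (Metric.ball 0 R) 0 :=
    fun z hz => ⟨Metric.isOpen_ball, properOn_of_isBounded hbR (by fun_prop), fun x hx h0 => by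
      have h1 := hfr x hx
      rw [sub_eq_zero.1 (hinj _ h0)] at h1
      linarith⟩
  have hadm0 : Admissible (fun x => A x) (Metric.ball 0 R) 0 := by
    simpa using hadm 0 (by simpa using one_pos.trans_le h1R)
  have e1 := hd.excision (hadm x₀ hxR) hU hUR fun x hx0 => by
    have := sub_eq_zero.1 (hinj _ hx0.1)
    rwa [this]
  have e2 := hd.excision hadm0 Metric.isOpen_ball
    (Metric.ball_subset_ball h1R) fun x hx0 => by
      have : x = 0 := hinj _ hx0.1
      rw [this]
      exact Metric.mem_ball_self one_pos
  rw [← e1, ← e2]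
  refine hd.affine_homotopy Metric.isOpen_ball hbR (by fun_prop) (by fun_prop)
    fun x hx t ht h0 => ?_
  -- The unique zero of the homotopy is `(1 - t) • x₀`, which never leaves the ball of radius `R`.
  have h2 : A (x - (1 - t) • x₀) = 0 := by
    rw [← h0]
    simp only [map_sub, map_smul, sub_zero]
    module
  have h3 := sub_eq_zero.1 (hinj _ h2)
  have h4 := hfr x hx
  rw [h3, norm_smul, Real.norm_of_nonneg (sub_nonneg.2 ht.2)] at h4
  nlinarith [norm_nonneg x₀, ht.1]

theorem linear_homotopy (hd : IsAmannWeissDegree d) {A B : Euc k →L[ℝ] Euc k}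
    (h : ∀ t ∈ Icc (0 : ℝ) 1, ((1 - t) • A + t • B).det ≠ 0) :
    d (fun x => A x) (Metric.ball 0 1) 0 = d (fun x => B x) (Metric.ball 0 1) 0 := by
  refine hd.affine_homotopy Metric.isOpen_ball Metric.isBounded_ball (by fun_prop) (by fun_prop)
    fun x hx t ht h0 => ?_
  have h1 : ((1 - t) • A + t • B) x = 0 := by simpa using h0
  have h2 : x = 0 := injective_of_det_ne_zero (h t ht) (h1.trans (map_zero _).symm)
  rw [Metric.isOpen_ball.frontier_eq] at hx
  exact hx.2 (h2 ▸ Metric.mem_ball_self one_pos)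

/-- Composition with the reflection in a coordinate hyperplane changes the sign of the degree. -/
theorem linear_comp_reflection (hd : IsAmannWeissDegree d) {A B : Euc k →L[ℝ] Euc k}
    (hA : A.det ≠ 0) (hB : B.det ≠ 0) (i : Fin k)
    (hAB : ∀ x, B x = A (x - (2 * x i) • EuclideanSpace.single i 1)) :
    d (fun x => B x) (Metric.ball 0 1) 0 = - d (fun x => A x) (Metric.ball 0 1) 0 := by
  have hinj : ∀ v, A v = 0 → v = 0 := fun v hv =>
    injective_of_det_ne_zero hA (hv.trans A.map_zero.symm)
  set e : Euc k := EuclideanSpace.single i 1 with he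
  have hei : e i = 1 := by simp [he]
  have hnorm : ‖e‖ = 1 := by simp [he]
  -- The fold: before `A` is applied, the coordinate `x i` is replaced by `|x i| + s`. For `s = 1`
  -- there is no zero; for `s = -1` the zeros are `e` and `-e`.
  set q : ℝ → Euc k → Euc k := fun s x => A (x + (|x i| + s - x i) • e) with hq
  have hqc : ∀ s, Continuous (q s) := fun s => by
    simp only [hq]
    fun_prop
  have hzero : ∀ s x, q s x = 0 → |x i| = -s ∧ x = x i • e := by
    intro s x hx
    have h1 := hinj _ hx
    have h2 : |x i| = -s := by
      have := congrArg (fun v : Euc k => v i) h1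
      simp only [PiLp.add_apply, PiLp.smul_apply, hei, smul_eq_mul, PiLp.zero_apply] at this
      linarith
    refine ⟨h2, ?_⟩
    rw [h2, neg_add_cancel, zero_sub, neg_smul, ← sub_eq_add_neg] at h1
    exact sub_eq_zero.1 h1
  have hxn : ∀ s x, q s x = 0 → ‖x‖ = -s := fun s x hx => by
    obtain ⟨h1, h2⟩ := hzero s x hx
    rw [h2, norm_smul, hnorm, mul_one, Real.norm_eq_abs, h1]
  set V := Metric.ball (0 : Euc k) 3 with hV
  have hVb : Bornology.IsBounded V := Metric.isBounded_ball
  have hVfr : ∀ x ∈ frontier V, 3 ≤ ‖x‖ := fun x hx => le_norm_of_mem_frontier_ball hx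
  have hadm : ∀ s, -3 < s → Admissible (q s) V 0 := fun s hs =>
    ⟨Metric.isOpen_ball, properOn_of_isBounded hVb (hqc s).continuousOn, fun x hx h0 => by
      have h1 := hxn s x h0
      have h2 := hVfr x hx
      linarith⟩
  -- The segment from `q (-1)` to `q 1` passes through `q (-1 + 2 * t)`, whose zeros have norm at
  -- most 1, far from the sphere of radius 3.
  have hvanish : d (q (-1)) V 0 = 0 := by
    rw [← hd.eq_zero (hadm 1 (by norm_num)) fun x _ h0 => by
      have := hxn 1 x h0
      linarith [norm_nonneg x]]
    refine hd.affine_homotopy Metric.isOpen_ball hVb (hqc _).continuousOn (hqc _).continuousOn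
      fun x hx t ht h0 => ?_
    have h1 : q (-1 + 2 * t) x = 0 := by
      rw [← h0]
      simp only [hq, map_add, map_smul, sub_zero]
      module
    have h2 := hxn _ x h1
    have h3 := hVfr x hx
    linarith [ht.1]
  set U₁ := V ∩ {x | 0 < x i} with hU₁
  set U₂ := V ∩ {x | x i < 0} with hU₂
  have hci : Continuous fun x : Euc k => x i := by fun_prop
  have ho₁ : IsOpen U₁ := Metric.isOpen_ball.inter (isOpen_lt continuous_const hci)
  have ho₂ : IsOpen U₂ := Metric.isOpen_ball.inter (isOpen_lt hci continuous_const)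
  have hc₁ : ∀ x ∈ closure U₁, 0 ≤ x i := fun x hx =>
    closure_minimal (show U₁ ⊆ {z | 0 ≤ z i} from fun z hz => (show 0 < z i from hz.2).le)
      (isClosed_le continuous_const hci) hx
  have hc₂ : ∀ x ∈ closure U₂, x i ≤ 0 := fun x hx =>
    closure_minimal (show U₂ ⊆ {z | z i ≤ 0} from fun z hz => (show z i < 0 from hz.2).le)
      (isClosed_le hci continuous_const) hx
  have hne : ∀ x, q (-1) x = 0 → x i ≠ 0 := fun x hx h0 => by
    have := (hzero _ x hx).1
    rw [h0] at this
    norm_num at this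
  have hadd := hd.additivity (q (-1)) V 0 U₁ U₂ (hadm (-1) (by norm_num)) ho₁ ho₂
    inter_subset_left inter_subset_left
    (disjoint_left.2 fun x h1 h2 => lt_asymm (show 0 < x i from h1.2) h2.2)
    (fun x hx => (lt_or_gt_of_ne (hne x hx.1)).elim (fun h => Or.inr ⟨hx.2, h⟩)
      fun h => Or.inl ⟨hx.2, h⟩)
  have hadm₁ : Admissible (q (-1)) U₁ 0 := (hadm (-1) (by norm_num)).mono ho₁ inter_subset_left
    fun x hx hxc => ⟨hx.2, (hc₁ x hxc).lt_of_ne' (hne x hx.1)⟩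
  have hadm₂ : Admissible (q (-1)) U₂ 0 := (hadm (-1) (by norm_num)).mono ho₂ inter_subset_left
    fun x hx hxc => ⟨hx.2, (hc₂ x hxc).lt_of_ne (hne x hx.1)⟩
  -- On the side `x i ≥ 0` the fold is `A (x - e)`; on the other side it is `B (x + e)`.
  have e₁ : d (q (-1)) U₁ 0 = d (fun x => A x) (Metric.ball 0 1) 0 := by
    rw [← hd.linear_sub hA ho₁ (hVb.subset inter_subset_left) (x₀ := e)
      ⟨by rw [hV, mem_ball_zero_iff, hnorm]; norm_num, by simp [hei]⟩]
    refine hd.congr hadm₁ (hVb.subset inter_subset_left) fun x hx => ?_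
    simp only [hq]
    rw [abs_of_nonneg (hc₁ x hx)]
    congr 1
    module
  have e₂ : d (q (-1)) U₂ 0 = d (fun x => B x) (Metric.ball 0 1) 0 := by
    rw [← hd.linear_sub hB ho₂ (hVb.subset inter_subset_left) (x₀ := -e)
      ⟨by rw [hV, mem_ball_zero_iff, norm_neg, hnorm]; norm_num, by simp [hei]⟩]
    refine hd.congr hadm₂ (hVb.subset inter_subset_left) fun x hx => ?_
    simp only [hq]
    rw [abs_of_nonpos (hc₂ x hx), hAB]
    congr 1
    simp only [sub_neg_eq_add, PiLp.add_apply, hei]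
    module
  rw [hvanish, e₁, e₂] at hadd
  linarith

end IsAmannWeissDegree

theorem det_toEuclideanCLM {k : ℕ} (M : Matrix (Fin k) (Fin k) ℝ) :
    (Matrix.toEuclideanCLM (n := Fin k) (𝕜 := ℝ) M).det = M.det := by
  rw [ContinuousLinearMap.det, ← LinearMap.det_toMatrix (EuclideanSpace.basisFun (Fin k) ℝ).toBasis]
  congr 1
  ext i j
  simp [LinearMap.toMatrix_apply]

namespace IsAmannWeissDegree

variable {k : ℕ} {d : (Euc k → Euc k) → Set (Euc k) → Euc k → ℤ}

theorem matrix_homotopy (hd : IsAmannWeissDegree d) {M N : Matrix (Fin k) (Fin k) ℝ}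
    (h : ∀ t ∈ Icc (0 : ℝ) 1, ((1 - t) • M + t • N).det ≠ 0) :
    d (fun x => Matrix.toEuclideanCLM (n := Fin k) (𝕜 := ℝ) M x) (Metric.ball 0 1) 0 =
      d (fun x => Matrix.toEuclideanCLM (n := Fin k) (𝕜 := ℝ) N x) (Metric.ball 0 1) 0 := by
  refine hd.linear_homotopy fun t ht => ?_
  rw [← map_smul, ← map_smul, ← map_add, det_toEuclideanCLM]
  exact h t ht

/-- The entry `c` can be moved to 1 or -1 without crossing 0, and the entry -1 is a reflection. -/
theorem matrix_mul_single (hd : IsAmannWeissDegree d) {B : Matrix (Fin k) (Fin k) ℝ}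
    (hB : B.det ≠ 0) (i : Fin k) {c : ℝ} (hc : c ≠ 0) :
    d (fun x => Matrix.toEuclideanCLM (n := Fin k) (𝕜 := ℝ)
        (B * Matrix.diagonal (Function.update 1 i c)) x) (Metric.ball 0 1) 0 =
      ((SignType.sign c : SignType) : ℤ) *
        d (fun x => Matrix.toEuclideanCLM (n := Fin k) (𝕜 := ℝ) B x) (Metric.ball 0 1) 0 := by
  have hdet : ∀ c : ℝ, (B * Matrix.diagonal (Function.update 1 i c)).det = B.det * c := fun c => by
    rw [Matrix.det_mul, Matrix.det_diagonal, Finset.prod_update_of_mem (Finset.mem_univ i)]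
    simp
  have hcomb : ∀ c c' t : ℝ, (1 - t) • (B * Matrix.diagonal (Function.update 1 i c)) +
      t • (B * Matrix.diagonal (Function.update 1 i c')) =
      B * Matrix.diagonal (Function.update 1 i ((1 - t) * c + t * c')) := by
    intro c c' t
    rw [← Matrix.mul_smul, ← Matrix.mul_smul, ← Matrix.mul_add, ← Matrix.diagonal_smul,
      ← Matrix.diagonal_smul, Matrix.diagonal_add]
    congr 2
    funext j
    by_cases hj : j = i
    · subst hj; simp
    · simp [hj]
  rcases lt_or_gt_of_ne hc with hneg | hpos
  · rw [sign_neg hneg, hd.matrix_homotopy (N := B * Matrix.diagonal (Function.update 1 i (-1)))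
      fun t ht => by
        rw [hcomb, hdet]
        refine mul_ne_zero hB (ne_of_lt ?_)
        rcases eq_or_lt_of_le ht.1 with h0 | h0
        · rw [← h0]; simpa using hneg
        · nlinarith [ht.2]]
    rw [hd.linear_comp_reflection (A := Matrix.toEuclideanCLM (n := Fin k) (𝕜 := ℝ) B)
      (by rwa [det_toEuclideanCLM]) (by rw [det_toEuclideanCLM, hdet]; simpa using hB) i fun x => ?_]
    · simp
    · rw [map_mul]
      change Matrix.toEuclideanCLM (n := Fin k) (𝕜 := ℝ) B _ = _
      congr 1
      ext j
      by_cases hj : j = i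
      · subst hj
        simp [Matrix.mulVec_diagonal]
        ring
      · simp [Matrix.mulVec_diagonal, hj]
  · rw [sign_pos hpos, hd.matrix_homotopy (N := B * Matrix.diagonal (Function.update 1 i 1))
      fun t ht => by
        rw [hcomb, hdet]
        refine mul_ne_zero hB (ne_of_gt ?_)
        rcases eq_or_lt_of_le ht.1 with h0 | h0
        · rw [← h0]; simpa using hpos
        · nlinarith [ht.2]]
    have : Matrix.diagonal (Function.update (1 : Fin k → ℝ) i 1) = 1 := by
      rw [show (1 : ℝ) = (1 : Fin k → ℝ) i from rfl, Function.update_eq_self]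
      exact Matrix.diagonal_one
    rw [this]
    simp

/-- The left factor `B` is arbitrary so that the induction over a factorization of `M` can absorb
the factors already treated. -/
theorem matrix_mul (hd : IsAmannWeissDegree d) (M : Matrix (Fin k) (Fin k) ℝ) (hM : M.det ≠ 0) :
    ∀ B : Matrix (Fin k) (Fin k) ℝ, B.det ≠ 0 →
      d (fun x => Matrix.toEuclideanCLM (n := Fin k) (𝕜 := ℝ) (B * M) x) (Metric.ball 0 1) 0 =
        ((SignType.sign M.det : SignType) : ℤ) *
          d (fun x => Matrix.toEuclideanCLM (n := Fin k) (𝕜 := ℝ) B x) (Metric.ball 0 1) 0 := by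
  refine Matrix.diagonal_transvection_induction_of_det_ne_zero (fun M => ∀ B, B.det ≠ 0 →
      d (fun x => Matrix.toEuclideanCLM (n := Fin k) (𝕜 := ℝ) (B * M) x) (Metric.ball 0 1) 0 =
        ((SignType.sign M.det : SignType) : ℤ) *
          d (fun x => Matrix.toEuclideanCLM (n := Fin k) (𝕜 := ℝ) B x) (Metric.ball 0 1) 0)
    M hM ?_ ?_ ?_
  · intro D hD B hB
    have hDi : ∀ i, D i ≠ 0 := fun i => by
      rw [Matrix.det_diagonal] at hD
      exact Finset.prod_ne_zero_iff.1 hD i (Finset.mem_univ i)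
    have key : ∀ s : Finset (Fin k),
        d (fun x => Matrix.toEuclideanCLM (n := Fin k) (𝕜 := ℝ)
          (B * Matrix.diagonal (fun i => if i ∈ s then D i else 1)) x) (Metric.ball 0 1) 0 =
        ((SignType.sign (∏ i ∈ s, D i) : SignType) : ℤ) *
          d (fun x => Matrix.toEuclideanCLM (n := Fin k) (𝕜 := ℝ) B x) (Metric.ball 0 1) 0 := by
      intro s
      induction s using Finset.induction_on with
      | empty =>
        have : Matrix.diagonal (fun _ : Fin k => (1 : ℝ)) = 1 := Matrix.diagonal_one
        simp [this]
      | insert a s ha ih =>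
        have hmat : Matrix.diagonal (fun i => if i ∈ insert a s then D i else 1) =
            Matrix.diagonal (fun i => if i ∈ s then D i else 1) *
              Matrix.diagonal (Function.update 1 a (D a)) := by
          rw [Matrix.diagonal_mul_diagonal]
          congr 1
          funext i
          by_cases hi : i = a
          · subst hi; simp [ha]
          · simp [hi]
        have hdet : (B * Matrix.diagonal (fun i => if i ∈ s then D i else 1)).det ≠ 0 := by
          rw [Matrix.det_mul, Matrix.det_diagonal]
          refine mul_ne_zero hB (Finset.prod_ne_zero_iff.2 fun i _ => ?_)
          split_ifs
          · exact hDi i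
          · exact one_ne_zero
        rw [hmat, ← Matrix.mul_assoc, hd.matrix_mul_single hdet a (hDi a), ih,
          Finset.prod_insert ha, sign_mul]
        push_cast
        ring
    have := key Finset.univ
    simpa [Matrix.det_diagonal] using this
  · intro T B hB
    rw [Matrix.TransvectionStruct.det, sign_one]
    -- The segment shrinks the off-diagonal coefficient to 0 and leaves the determinant unchanged.
    have hpath : ∀ t : ℝ, (1 - t) • (B * T.toMatrix) + t • B =
        B * Matrix.transvection T.i T.j ((1 - t) * T.c) := by
      intro t
      have hs : Matrix.single T.i T.j ((1 - t) * T.c) = (1 - t) • Matrix.single T.i T.j T.c := by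
        rw [Matrix.smul_single, smul_eq_mul]
      rw [Matrix.TransvectionStruct.toMatrix, Matrix.transvection, Matrix.transvection, hs,
        Matrix.mul_add, Matrix.mul_add, Matrix.mul_one, Matrix.mul_smul]
      module
    rw [hd.matrix_homotopy (N := B) fun t _ => by
      rw [hpath, Matrix.det_mul, Matrix.det_transvection_of_ne _ _ T.hij, mul_one]
      exact hB]
    simp
  · intro M N hM hN ihM ihN B hB
    rw [← Matrix.mul_assoc, ihN (B * M) (by rw [Matrix.det_mul]; exact mul_ne_zero hB hM),
      ihM B hB, Matrix.det_mul, sign_mul]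
    push_cast
    ring

/-- Taking the left factor to be the identity leaves only its degree on the unit ball, which
excision obtains from normalization on the whole space. -/
theorem linear_ball (hd : IsAmannWeissDegree d) {A : Euc k →L[ℝ] Euc k} (hA : A.det ≠ 0) :
    d (fun x => A x) (Metric.ball 0 1) 0 = ((SignType.sign A.det : SignType) : ℤ) := by
  obtain ⟨M, rfl⟩ : ∃ M, Matrix.toEuclideanCLM (n := Fin k) (𝕜 := ℝ) M = A :=
    (Matrix.toEuclideanCLM (n := Fin k) (𝕜 := ℝ)).surjective A
  rw [det_toEuclideanCLM] at hA ⊢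
  have h := hd.matrix_mul M hA 1 (by simp)
  rw [one_mul] at h
  rw [h, map_one]
  have hid : (ContinuousLinearMap.id ℝ (Euc k)).det ≠ 0 := by simp [ContinuousLinearMap.det]
  have h1 := hd.excision (admissible_continuousLinearMap hid 0) (V := Metric.ball 0 1)
    Metric.isOpen_ball (subset_univ _) (by rintro x ⟨hx, -⟩; rw [show x = 0 from hx]; simp)
  have h2 : d (fun x => (1 : Euc k →L[ℝ] Euc k) x) (Metric.ball 0 1) 0 = 1 := by
    rw [← hd.normalization]
    exact h1.symm
  rw [h2, mul_one]

theorem sub_const (hd : IsAmannWeissDegree d) {f : Euc k → Euc k} {U : Set (Euc k)} {y : Euc k}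
    (h : Admissible f U y) (hb : Bornology.IsBounded U) :
    d f U y = d (fun x => f x - y) U 0 := by
  refine hd.affine_homotopy h.isOpen hb h.proper.1 (h.proper.1.sub continuousOn_const)
    fun x hx t _ => ?_
  rw [sub_zero, ← add_smul, sub_add_cancel, one_smul]
  exact sub_ne_zero.2 (h.boundary x hx)

/-- Excision to a ball around the unique solution makes the domain bounded, where the target can be
moved to 0. -/
theorem linear_univ (hd : IsAmannWeissDegree d) {L : Euc k →L[ℝ] Euc k} (hL : L.det ≠ 0)
    (y : Euc k) : d (fun x => L x) univ y = ((SignType.sign L.det : SignType) : ℤ) := by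
  obtain ⟨x₀, rfl⟩ := (L.toContinuousLinearEquivOfDetNeZero hL).surjective y
  change d (fun x => L x) univ (L x₀) = _
  have hadm := admissible_continuousLinearMap hL (L x₀)
  have hz : ∀ x, L x = L x₀ → x = x₀ := fun x hx => injective_of_det_ne_zero hL hx
  have hsub : (fun x => L x) ⁻¹' {L x₀} ∩ univ ⊆ Metric.ball x₀ 1 := fun x hx => by
    rw [hz x hx.1]; exact Metric.mem_ball_self one_pos
  rw [hd.excision hadm Metric.isOpen_ball (subset_univ _) hsub,
    hd.sub_const (hadm.mono Metric.isOpen_ball (subset_univ _) fun x hx _ => hsub hx)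
      Metric.isBounded_ball, ← hd.linear_ball hL,
    ← hd.linear_sub hL Metric.isOpen_ball Metric.isBounded_ball
      (Metric.mem_ball_self (x := x₀) one_pos)]
  simp only [map_sub]

/-! ### The computation formula from the axioms -/

/-- The computation formula for a degree satisfying the axioms of Amann and Weiss. -/
theorem eq_sum_index (hd : IsAmannWeissDegree d) {f : Euc k → Euc k} {U : Set (Euc k)} {y : Euc k}
    (h : Admissible f U y)
    (hdf : ∀ x ∈ f ⁻¹' {y} ∩ U, DifferentiableAt ℝ f x ∧ (fderiv ℝ f x).det ≠ 0) :
    d f U y = ∑ x ∈ (h.finite_preimage hdf).toFinset, index f x := by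
  set S := f ⁻¹' {y} ∩ U with hSdef
  have hS : S.Finite := h.finite_preimage hdf
  obtain ⟨r, hr, m, hm, hdisj, hloc⟩ := exists_radius_affine_approximation h.isOpen hS
    (y := y) fun x hx => ⟨hx.2, hx.1, hdf x hx⟩
  have hballU : ∀ x ∈ S, Metric.ball x r ⊆ U := fun x hx =>
    Metric.ball_subset_closedBall.trans (hloc x hx).1
  -- The closed balls are disjoint, so a solution in the closure of the union is the centre of one
  -- of the balls, hence not on the frontier.
  have hadm : ∀ s : Finset (Euc k), (∀ x ∈ s, x ∈ S) →
      Admissible f (⋃ x ∈ s, Metric.ball x r) y := by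
    intro s hs
    refine h.mono (isOpen_biUnion fun x _ => Metric.isOpen_ball)
      (iUnion₂_subset fun x hx => hballU x (hs x hx)) fun z hz hzc => ?_
    rw [s.closure_biUnion] at hzc
    obtain ⟨x, hx, hzx⟩ := mem_iUnion₂.1 hzc
    have : x = z := hdisj.elim_set (hs x hx) hz z (Metric.closure_ball_subset_closedBall hzx)
      (Metric.mem_closedBall_self hr.le)
    exact mem_biUnion hx (this ▸ Metric.mem_ball_self hr)
  have hsum : ∀ s : Finset (Euc k), (∀ x ∈ s, x ∈ S) →
      d f (⋃ x ∈ s, Metric.ball x r) y = ∑ x ∈ s, d f (Metric.ball x r) y := by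
    intro s
    induction s using Finset.induction_on with
    | empty => intro _; simp [hd.empty]
    | insert a s ha ih =>
      intro hs
      have hsub : ∀ x ∈ s, x ∈ S := fun x hx => hs x (Finset.mem_insert_of_mem hx)
      have hd2 : Disjoint (Metric.ball a r) (⋃ x ∈ s, Metric.ball x r) :=
        disjoint_iUnion₂_right.2 fun x hx => (hdisj (hs a (Finset.mem_insert_self a s)) (hsub x hx)
          (ne_of_mem_of_not_mem hx ha).symm).mono Metric.ball_subset_closedBall
            Metric.ball_subset_closedBall
      have hun : ⋃ x ∈ insert a s, Metric.ball x r =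
          Metric.ball a r ∪ ⋃ x ∈ s, Metric.ball x r := by simp
      rw [hd.additivity f _ y (Metric.ball a r) (⋃ x ∈ s, Metric.ball x r) (hadm _ hs)
        Metric.isOpen_ball (isOpen_biUnion fun x _ => Metric.isOpen_ball)
        (hun ▸ subset_union_left) (hun ▸ subset_union_right) hd2
        (fun x hx => hun ▸ hx.2), ih hsub, Finset.sum_insert ha]
  have hSmem : ∀ x ∈ hS.toFinset, x ∈ S := fun x hx => hS.mem_toFinset.1 hx
  rw [hd.excision h (V := ⋃ x ∈ hS.toFinset, Metric.ball x r)
    (isOpen_biUnion fun x _ => Metric.isOpen_ball)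
    (iUnion₂_subset fun x hx => hballU x (hSmem x hx))
    (fun x hx => mem_biUnion (hS.mem_toFinset.2 hx) (Metric.mem_ball_self hr)), hsum _ hSmem]
  refine Finset.sum_congr rfl fun x hx => ?_
  have hxS := hSmem x hx
  have hdet := (hdf x hxS).2
  have hfc : ContinuousOn f (closure (Metric.ball x r)) :=
    h.proper.1.mono (closure_mono (hballU x hxS))
  rw [index, ← hd.linear_ball hdet, ← hd.linear_sub hdet Metric.isOpen_ball Metric.isBounded_ball
    (Metric.mem_ball_self hr)]
  -- No smoothing is needed: on the sphere of radius `r` the segment from `f - y` to the derivative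
  -- has norm at least `m * r`.
  refine hd.affine_homotopy Metric.isOpen_ball Metric.isBounded_ball hfc (by fun_prop)
    fun z hz t ht h0 => ?_
  have h1 := (hloc x hxS).2 z
    (Metric.closure_ball_subset_closedBall (frontier_subset_closure hz)) t ht
  rw [sub_zero] at h0
  rw [h0, norm_zero] at h1
  rw [Metric.isOpen_ball.frontier_eq] at hz
  have h2 : r ≤ ‖z - x‖ := by
    by_contra! hlt
    exact hz.2 (mem_ball_iff_norm.2 hlt)
  nlinarith

end IsAmannWeissDegree

/-- Here the linear case is an instance of the computation formula, with the preimage of `y` as the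
only solution. -/
theorem brouwerDegree_linear {k : ℕ} {L : Euc k →L[ℝ] Euc k} (hL : L.det ≠ 0) (y : Euc k) :
    brouwerDegree (fun x => L x) univ y = ((SignType.sign L.det : SignType) : ℤ) := by
  have hder : ∀ x, fderiv ℝ (fun x => L x) x = L := fun x => L.hasFDerivAt.fderiv
  rw [brouwerDegree_eq_sum_index (admissible_continuousLinearMap hL y)
    fun x _ => ⟨L.differentiableAt, by rwa [hder]⟩]
  obtain ⟨x₀, rfl⟩ := (L.toContinuousLinearEquivOfDetNeZero hL).surjective y
  rw [Finset.sum_eq_single x₀]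
  · rw [index, hder]
  · intro x hx hne
    exact absurd (injective_of_det_ne_zero hL ((Finite.mem_toFinset _).1 hx).1) hne
  · intro hx
    rw [Finite.mem_toFinset] at hx
    exact absurd ⟨rfl, mem_univ _⟩ hx

theorem mainTheorem4 (k : ℕ) (d : (Euc k → Euc k) → Set (Euc k) → Euc k → ℤ)
    (hd : IsAmannWeissDegree d ∨ d = brouwerDegree) :
    (∀ L : Euc k →L[ℝ] Euc k, L.det ≠ 0 → ∀ y : Euc k,
      d (fun x => L x) Set.univ y = ((SignType.sign L.det : SignType) : ℤ)) ∧
    (∀ (f : Euc k → Euc k) (U : Set (Euc k)) (y : Euc k), Admissible f U y →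
      (∀ x ∈ f ⁻¹' {y} ∩ U, DifferentiableAt ℝ f x ∧ (fderiv ℝ f x).det ≠ 0) →
      ∃ hfin : (f ⁻¹' {y} ∩ U).Finite, d f U y = ∑ x ∈ hfin.toFinset, index f x) := by
  rcases hd with hd | rfl
  · exact ⟨fun L hL y => hd.linear_univ hL y,
      fun f U y h hdf => ⟨h.finite_preimage hdf, hd.eq_sum_index h hdf⟩⟩
  · exact ⟨fun L hL y => brouwerDegree_linear hL y,
      fun f U y h hdf => ⟨h.finite_preimage hdf, brouwerDegree_eq_sum_index h hdf⟩⟩
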